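/- A \emph{local group} is a Hausdorff space $G$ with a point $1\in G$ and continuous maps $\iota:\Lambda\to G$, $x\mapsto x^{-1}$, and $p:\Omega\to G$, $(x,y)\mapsto xy$, with $\Lambda\subseteq G$ and $\Omega\subseteq G\times G$ open, $1\in\Lambda$, $\{1\}\times G\subseteq\Omega$, $G\times\{1\}\subseteq\Omega$, such that $1x=x1=x$; if $x\in\Lambda$ then $(x,x^{-1}),(x^{-1},x)\in\Omega$ and $xx^{-1}=x^{-1}x=1$; and $(xy)z=x(yz)$ whenever $(x,y),(y,z),(xy,z),(x,yz)\in\Omega$. A product $a_1\cdots a_n$ is \emph{defined} if all ways of bracketing it are defined and give the same value. A set $W\subseteq G$ is \emph{symmetric} if $W\subseteq\Lambda$ and $W=\iota(W)$. For an open neighbourhood $U$ of $1$, the \emph{restriction} $G|U$ is the local group on $U$ whose inversion has domain $\Lambda\cap U\cap\iota^{-1}(U)$ and whose product has domain $\Omega\cap(U\times U)\cap p^{-1}(U)$. A \emph{local 1-parameter subgroup} of $G$ is a continuous map $X:(-r,r)\to G$, $r\in(0,\infty]$, with image in $\Lambda$, such that $(X(s),X(t))\in\Omega$ and $X(s+t)=X(s)X(t)$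 whenever $s,t,s+t\in(-r,r)$. $L(G)$ denotes the set of germs at $0$ of local 1-parameter subgroups of $G$. A \emph{morphism} of local groups is a continuous map that sends $1$ to $1$, respects the domains of inversion and product, and commutes with these operations. A \emph{local morphism} $f:G\to G'$ is a germ at $1$ of morphisms $G|U\to G'$ ($U$ an open neighbourhood of $1$); it induces $L(f):L(G)\to L(G')$, $[X]\mapsto[f\circ X]$ (after restricting $X$ to a small interval around $0$). A \emph{normal sublocal group} of $G$ with normalizing neighbourhood $V$ is a set $H\ni 1$, where $V$ is a symmetric open neighbourhood of $1$, such that $H\subseteq V$ is closed in $V$; $x\in H\cap\Lambda$ and $x^{-1}\in V$ imply $x^{-1}\in H$; $x,y\in H$, $(x,y)\in\Omega$ and $xy\in V$ imply $xy\in H$; and $y\in V$, $x\in H$, $yxy^{-1}$ defined and in $V$ imply $yxy^{-1}\in H$. Let $W$ be a symmetric open neighbourhood of $1$ such that all sixfold products of elements of $W$ are defined and lie in $V$. Then $x\sim y\iff x^{-1}y\in H$ is an equivalence relation on $W$, and $G/H:=(G/H)_W$ is the local group on the quotient space $W/{\sim}$ with identity $[1]$, $[x]^{-1}=[x^{-1}]$,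 and $[x][y]=[xy]$ for $x,y\in W$ with $xy\in W$ (the product being defined on exactly these pairs of classes). Let $\pi:G\to G/H$ be the local morphism represented by the canonical map $W\to W/{\sim}$, a morphism $G|W\to(G/H)_W$. \textbf{Lemma.} Let $G$ be a locally compact local group with $\Lambda=G$ and such that $(g,h)\in\Omega$ implies $(h^{-1},g^{-1})\in\Omega$ and $(gh)^{-1}=h^{-1}g^{-1}$. Let $H$ be a normal sublocal group of $G$, with normalizing neighbourhood $V$, which is totally disconnected, and let $W$ be as above. Then $L(\pi):L(G)\to L(G/H)$ is surjective; that is, for every local 1-parameter subgroup $Y$ of $G/H$ there is a local 1-parameter subgroup $X$ of $G$ such that $\pi\circ X$ and $Y$ agree near $0$. -/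

import Mathlib

open Set Topology

universe u v

/-- A local group structure on a (Hausdorff) topological space `G`. The inversion `inv` and the
product `mul` are partial maps with open domains `invDom` and `mulDom`; they are
represented by total functions, whose values outside these domains are never used. -/
structure LocalGroup (G : Type u) [TopologicalSpace G] where
  t2 : T2Space G
  one : G
  invDom : Set G
  mulDom : Set (G × G)
  inv : G → G
  mul : G → G → G
  isOpen_invDom : IsOpen invDom
  isOpen_mulDom : IsOpen mulDom
  continuousOn_inv : ContinuousOn inv invDom
  continuousOn_mul : ContinuousOn (fun p : G × G => mul p.1 p.2) mulDom
  one_mem_invDom : one ∈ invDom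
  one_left_mem : ∀ x, (one, x) ∈ mulDom
  one_right_mem : ∀ x, (x, one) ∈ mulDom
  one_mul : ∀ x, mul one x = x
  mul_one : ∀ x, mul x one = x
  mul_inv_mem : ∀ x ∈ invDom, (x, inv x) ∈ mulDom
  inv_mul_mem : ∀ x ∈ invDom, (inv x, x) ∈ mulDom
  mul_inv : ∀ x ∈ invDom, mul x (inv x) = one
  inv_mul : ∀ x ∈ invDom, mul (inv x) x = one
  assoc : ∀ x y z, (x, y) ∈ mulDom → (y, z) ∈ mulDom → (mul x y, z) ∈ mulDom →
    (x, mul y z) ∈ mulDom → mul (mul x y) z = mul x (mul y z)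

namespace LocalGroup

section Basic

variable {G : Type u} [TopologicalSpace G] (A : LocalGroup G)

theorem eq_inv_of_mul_eq_one {x y : G} (hx : x ∈ A.invDom) (hxy : (x, y) ∈ A.mulDom)
    (h : A.mul x y = A.one) : y = A.inv x := by
  have := A.assoc (A.inv x) x y (A.inv_mul_mem x hx) hxy
    (by rw [A.inv_mul x hx]; exact A.one_left_mem y) (by rw [h]; exact A.one_right_mem _)
  rwa [A.inv_mul x hx, h, A.one_mul, A.mul_one] at this

theorem inv_one : A.inv A.one = A.one :=
  (A.eq_inv_of_mul_eq_one A.one_mem_invDom (A.one_left_mem _) (A.one_mul _)).symm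

theorem inv_inv {x : G} (hx : x ∈ A.invDom) (hx' : A.inv x ∈ A.invDom) :
    A.inv (A.inv x) = x :=
  (A.eq_inv_of_mul_eq_one hx' (A.inv_mul_mem x hx) (A.inv_mul x hx)).symm

open Classical in
/-- The restriction `G|U` of a local group to an open neighbourhood `U` of `1`: its
inversion has domain `Λ ∩ U ∩ ι⁻¹(U)` and its product has domain `Ω ∩ (U × U) ∩ p⁻¹(U)`. -/
noncomputable def restrict (U : Set G) (hU : IsOpen U) (h1 : A.one ∈ U) : LocalGroup U where
  t2 := haveI := A.t2; inferInstance
  one := ⟨A.one, h1⟩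
  invDom := {x | (x : G) ∈ A.invDom ∧ A.inv x ∈ U}
  mulDom := {p | ((p.1 : G), (p.2 : G)) ∈ A.mulDom ∧ A.mul p.1 p.2 ∈ U}
  inv x := if h : A.inv x ∈ U then ⟨A.inv x, h⟩ else ⟨A.one, h1⟩
  mul x y := if h : A.mul x y ∈ U then ⟨A.mul x y, h⟩ else ⟨A.one, h1⟩
  isOpen_invDom := by
    have := (A.continuousOn_inv.isOpen_inter_preimage A.isOpen_invDom hU).preimage
      (continuous_subtype_val (p := fun x => x ∈ U))
    exact this
  isOpen_mulDom := by
    have := (A.continuousOn_mul.isOpen_inter_preimage A.isOpen_mulDom hU).preimage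
      ((continuous_subtype_val (p := fun x => x ∈ U)).prodMap
        (continuous_subtype_val (p := fun x => x ∈ U)))
    exact this
  continuousOn_inv := by
    rw [IsInducing.subtypeVal.continuousOn_iff]
    refine ContinuousOn.congr (f := fun x : U => A.inv x) ?_ ?_
    · exact A.continuousOn_inv.comp continuous_subtype_val.continuousOn (fun x hx => hx.1)
    · intro x hx
      simp only [Function.comp_apply, dif_pos hx.2]
  continuousOn_mul := by
    rw [IsInducing.subtypeVal.continuousOn_iff]
    refine ContinuousOn.congr (f := fun x : U × U => A.mul x.1 x.2) ?_ ?_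
    · exact A.continuousOn_mul.comp
        (continuous_subtype_val.prodMap continuous_subtype_val).continuousOn (fun x hx => hx.1)
    · intro x hx
      simp only [Function.comp_apply, dif_pos hx.2]
  one_mem_invDom := ⟨A.one_mem_invDom, by simpa [A.inv_one] using h1⟩
  one_left_mem x := ⟨A.one_left_mem _, by simp [A.one_mul]⟩
  one_right_mem x := ⟨A.one_right_mem _, by simp [A.mul_one]⟩
  one_mul x := by simp [A.one_mul]
  mul_one x := by simp [A.mul_one]
  mul_inv_mem x hx := by
    simp only [mem_ofPred_eq, dif_pos hx.2, A.mul_inv x hx.1]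
    exact ⟨A.mul_inv_mem x hx.1, h1⟩
  inv_mul_mem x hx := by
    simp only [mem_ofPred_eq, dif_pos hx.2, A.inv_mul x hx.1]
    exact ⟨A.inv_mul_mem x hx.1, h1⟩
  mul_inv x hx := by
    simp only [dif_pos hx.2, A.mul_inv x hx.1, dif_pos h1]
  inv_mul x hx := by
    simp only [dif_pos hx.2, A.inv_mul x hx.1, dif_pos h1]
  assoc x y z hxy hyz h1 h2 := by
    simp only [mem_ofPred_eq, dif_pos hxy.2, dif_pos hyz.2] at h1 h2 ⊢
    simp only [A.assoc x y z hxy.1 hyz.1 h1.1 h2.1]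

/-- `(a₁, …, aₙ)` represents `b`: all ways of bracketing the product are defined, with value `b`.
The empty sequence represents `1`. -/
def Represents : List G → G → Prop
  | [], b => b = A.one
  | [a], b => b = a
  | a₁ :: a₂ :: l, b => ∀ i : Fin (l.length + 1), ∃ b' b'' : G,
      Represents ((a₁ :: a₂ :: l).take (i + 1)) b' ∧
      Represents ((a₁ :: a₂ :: l).drop (i + 1)) b'' ∧
      (b', b'') ∈ A.mulDom ∧ A.mul b' b'' = b
termination_by l => l.length
decreasing_by
  all_goals simp
  all_goals omega

/-- `W` is symmetric: `W ⊆ Λ` and `W = ι(W)`. -/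
def IsSymmetric (W : Set G) : Prop := W ⊆ A.invDom ∧ W = A.inv '' W

/-- `H` is a normal sublocal group with associated normalizing neighbourhood `V`. -/
structure IsNormalSublocalGroup (H V : Set G) : Prop where
  isOpen : IsOpen V
  one_mem_nhd : A.one ∈ V
  symm : A.IsSymmetric V
  one_mem : A.one ∈ H
  subset : H ⊆ V
  isClosed : IsClosed ((↑) ⁻¹' H : Set V)
  inv_mem : ∀ x ∈ H, x ∈ A.invDom → A.inv x ∈ V → A.inv x ∈ H
  mul_mem : ∀ x ∈ H, ∀ y ∈ H, (x, y) ∈ A.mulDom → A.mul x y ∈ V → A.mul x y ∈ H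
  conj_mem : ∀ y ∈ V, ∀ x ∈ H, ∀ b ∈ V, A.Represents [y, x, A.inv y] b → b ∈ H

/-- `W` is a symmetric open neighbourhood of `1` such that all sixfold products of elements of `W`
are defined and `W⁶ ⊆ V`. -/
structure IsCosetNhd (V W : Set G) : Prop where
  isOpen : IsOpen W
  one_mem : A.one ∈ W
  symm : A.IsSymmetric W
  six : ∀ l : List G, l.length = 6 → (∀ a ∈ l, a ∈ W) → ∃ b ∈ V, A.Represents l b

/-- The product `a₁(a₂(⋯ aₙ))`; an auxiliary function. -/
def prodList (l : List G) : G := l.foldr A.mul A.one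

end Basic

section Products

variable {G : Type u} [TopologicalSpace G] {A : LocalGroup G} {H V W : Set G}

theorem Represents.split {l₁ l₂ : List G} {b : G} (h : A.Represents (l₁ ++ l₂) b)
    (h₁ : l₁ ≠ []) (h₂ : l₂ ≠ []) : ∃ b' b'' : G, A.Represents l₁ b' ∧ A.Represents l₂ b'' ∧
      (b', b'') ∈ A.mulDom ∧ A.mul b' b'' = b := by
  obtain ⟨a, t, rfl⟩ := List.exists_cons_of_ne_nil h₁
  obtain ⟨c, s, rfl⟩ := List.exists_cons_of_ne_nil h₂
  obtain ⟨d, m, hd⟩ : ∃ d m, t ++ c :: s = d :: m :=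
    List.exists_cons_of_ne_nil (by simp)
  have hl := congrArg List.length hd
  simp only [List.length_append, List.length_cons] at hl
  rw [List.cons_append, hd, Represents] at h
  obtain ⟨b', b'', k⟩ := h ⟨t.length, by omega⟩
  refine ⟨b', b'', ?_⟩
  rw [← hd] at k
  simpa using k

theorem Represents.eq_prodList : ∀ {l : List G} {b : G}, A.Represents l b → b = A.prodList l
  | [], b, h => by simpa [Represents, prodList] using h
  | [a], b, h => by simpa [Represents, prodList, A.mul_one] using h
  | a₁ :: a₂ :: l, b, h => by
    obtain ⟨b', b'', h', h'', -, rfl⟩ :=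
      Represents.split (l₁ := [a₁]) (l₂ := a₂ :: l) h (by simp) (by simp)
    rw [h''.eq_prodList]
    simp only [Represents] at h'
    rw [h']
    rfl

namespace IsCosetNhd

theorem inv_mem (hw : A.IsCosetNhd V W) {x : G} (hx : x ∈ W) : A.inv x ∈ W := by
  rw [hw.symm.2]; exact mem_image_of_mem _ hx

theorem inv_inv (hw : A.IsCosetNhd V W) {x : G} (hx : x ∈ W) : A.inv (A.inv x) = x :=
  A.inv_inv (hw.symm.1 hx) (hw.symm.1 (hw.inv_mem hx))

theorem represents_prodList (hw : A.IsCosetNhd V W) {l : List G} (hl : l.length ≤ 6)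
    (hlW : ∀ a ∈ l, a ∈ W) : A.Represents l (A.prodList l) ∧ A.prodList l ∈ V := by
  obtain ⟨b, hb, h⟩ := hw.six (l ++ List.replicate (6 - l.length) A.one) (by simp; omega) (by
    intro a ha
    rcases List.mem_append.1 ha with ha | ha
    · exact hlW a ha
    · rw [(List.mem_replicate.1 ha).2]; exact hw.one_mem)
  have e : ∀ k, A.prodList (List.replicate k A.one) = A.one := by
    intro k
    induction k with
    | zero => rfl
    | succ k ih => rw [List.replicate_succ]; exact (A.one_mul _).trans ih
  have hP : b = A.prodList l := by
    rw [h.eq_prodList]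
    have e' := e (6 - l.length)
    unfold prodList at e' ⊢
    rw [List.foldr_append, e']
  refine ⟨?_, hP ▸ hb⟩
  rcases eq_or_ne l [] with rfl | h0
  · simp [Represents, prodList]
  rcases eq_or_ne (List.replicate (6 - l.length) A.one) [] with h2 | h2
  · rw [h2, List.append_nil] at h
    rwa [← hP]
  · obtain ⟨b', -, h', -⟩ := h.split h0 h2
    rwa [← h'.eq_prodList]

theorem prodList_append (hw : A.IsCosetNhd V W) {l₁ l₂ : List G}
    (hl : (l₁ ++ l₂).length ≤ 6) (hlW : ∀ a ∈ l₁ ++ l₂, a ∈ W) :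
    (A.prodList l₁, A.prodList l₂) ∈ A.mulDom ∧
      A.prodList (l₁ ++ l₂) = A.mul (A.prodList l₁) (A.prodList l₂) := by
  rcases eq_or_ne l₁ [] with rfl | h1
  · exact ⟨A.one_left_mem _, (A.one_mul _).symm⟩
  rcases eq_or_ne l₂ [] with rfl | h2
  · rw [List.append_nil]; exact ⟨A.one_right_mem _, (A.mul_one _).symm⟩
  obtain ⟨b', b'', h', h'', hm, he⟩ := (hw.represents_prodList hl hlW).1.split h1 h2
  rw [← h'.eq_prodList, ← h''.eq_prodList]
  exact ⟨hm, he.symm⟩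

theorem prodList_congr (hw : A.IsCosetNhd V W) (l₁ : List G) {m m' : List G} (l₂ : List G)
    (e : A.prodList m = A.prodList m')
    (hl : (l₁ ++ (m ++ l₂)).length ≤ 6) (hlW : ∀ a ∈ l₁ ++ (m ++ l₂), a ∈ W)
    (hl' : (l₁ ++ (m' ++ l₂)).length ≤ 6) (hlW' : ∀ a ∈ l₁ ++ (m' ++ l₂), a ∈ W) :
    A.prodList (l₁ ++ (m ++ l₂)) = A.prodList (l₁ ++ (m' ++ l₂)) := by
  have k := (hw.prodList_append (l₁ := m) (l₂ := l₂)
    (by rw [List.length_append] at hl; omega)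
    (fun a ha => hlW a (List.mem_append_right _ ha))).2
  have k' := (hw.prodList_append (l₁ := m') (l₂ := l₂)
    (by rw [List.length_append] at hl'; omega)
    (fun a ha => hlW' a (List.mem_append_right _ ha))).2
  rw [(hw.prodList_append hl hlW).2, (hw.prodList_append hl' hlW').2, k, k', e]

end IsCosetNhd

end Products

section Coset

variable {G : Type u} [TopologicalSpace G] {A : LocalGroup G} {H V W : Set G}

theorem represents_pair {a b : G} (h : (a, b) ∈ A.mulDom) :
    A.Represents [a, b] (A.mul a b) := by
  rw [Represents]
  intro i
  obtain rfl : i = 0 := Subsingleton.elim (α := Fin 1) i 0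
  exact ⟨a, b, by simp [Represents], by simp [Represents], h, rfl⟩

namespace IsCosetNhd

theorem prodList_pair (x y : G) : A.prodList [x, y] = A.mul x y := by
  simp [prodList, A.mul_one]

theorem prodList_single (x : G) : A.prodList [x] = x := by
  simp [prodList, A.mul_one]

theorem mul_mem_dom (hw : A.IsCosetNhd V W) {x y : G} (hx : x ∈ W) (hy : y ∈ W) :
    (x, y) ∈ A.mulDom := by
  have := (hw.prodList_append (l₁ := [x]) (l₂ := [y]) (by simp) (by simp [hx, hy])).1
  rwa [prodList_single, prodList_single] at this

theorem cancel (hw : A.IsCosetNhd V W) (l₁ : List G) {x : G} (l₂ : List G)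
    (hl : l₁.length + l₂.length ≤ 4) (h₁ : ∀ a ∈ l₁, a ∈ W) (hx : x ∈ W) (h₂ : ∀ a ∈ l₂, a ∈ W) :
    A.prodList (l₁ ++ x :: A.inv x :: l₂) = A.prodList (l₁ ++ l₂) := by
  have hx' := hw.inv_mem hx
  refine hw.prodList_congr l₁ (m := [x, A.inv x]) (m' := []) l₂ ?_ ?_ ?_ ?_ ?_
  · rw [prodList_pair, A.mul_inv x (hw.symm.1 hx)]; rfl
  · simp; omega
  · simp [or_imp, forall_and, hx, hx']; exact ⟨h₁, h₂⟩
  · simp; omega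
  · simp [or_imp, forall_and]; exact ⟨h₁, h₂⟩

theorem cancel' (hw : A.IsCosetNhd V W) (l₁ : List G) {x : G} (l₂ : List G)
    (hl : l₁.length + l₂.length ≤ 4) (h₁ : ∀ a ∈ l₁, a ∈ W) (hx : x ∈ W) (h₂ : ∀ a ∈ l₂, a ∈ W) :
    A.prodList (l₁ ++ A.inv x :: x :: l₂) = A.prodList (l₁ ++ l₂) := by
  have := hw.cancel l₁ l₂ hl h₁ (hw.inv_mem hx) h₂
  rwa [hw.inv_inv hx] at this

theorem prodList_inv (hw : A.IsCosetNhd V W) : ∀ l : List G, l.length ≤ 3 → (∀ a ∈ l, a ∈ W) →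
    A.prodList (l ++ (l.map A.inv).reverse) = A.one
  | [], _, _ => rfl
  | [x], _, h => by
    simp only [List.mem_cons, List.not_mem_nil, or_false, forall_eq] at h
    exact hw.cancel [] [] (by simp) (by simp) h (by simp)
  | [x, y], _, h => by
    simp only [List.mem_cons, List.not_mem_nil, or_false, forall_eq_or_imp, forall_eq] at h
    have hx' := hw.inv_mem h.1
    exact (hw.cancel [x] [A.inv x] (by simp) (by simp [h]) h.2 (by simp [hx'])).trans
      (hw.cancel [] [] (by simp) (by simp) h.1 (by simp))
  | [x, y, z], _, h => by
    simp only [List.mem_cons, List.not_mem_nil, or_false, forall_eq_or_imp, forall_eq] at h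
    have hx' := hw.inv_mem h.1
    have hy' := hw.inv_mem h.2.1
    exact ((hw.cancel [x, y] [A.inv y, A.inv x] (by simp) (by simp [h]) h.2.2
      (by simp [hx', hy'])).trans
      (hw.cancel [x] [A.inv x] (by simp) (by simp [h]) h.2.1 (by simp [hx']))).trans
      (hw.cancel [] [] (by simp) (by simp) h.1 (by simp))
  | _ :: _ :: _ :: _ :: _, h, _ => by simp only [List.length_cons] at h; omega

theorem inv_prodList (hn : A.IsNormalSublocalGroup H V) (hw : A.IsCosetNhd V W) {l : List G}
    (hl : l.length ≤ 3) (h : ∀ a ∈ l, a ∈ W) :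
    A.prodList ((l.map A.inv).reverse) = A.inv (A.prodList l) := by
  have h' : ∀ a ∈ l ++ (l.map A.inv).reverse, a ∈ W := by
    intro a ha
    simp only [List.mem_append, List.mem_reverse, List.mem_map] at ha
    rcases ha with ha | ⟨b, hb, rfl⟩
    · exact h a ha
    · exact hw.inv_mem (h b hb)
  have k := hw.prodList_append (l₁ := l) (l₂ := (l.map A.inv).reverse) (by simp; omega) h'
  refine A.eq_inv_of_mul_eq_one (hn.symm.1 (hw.represents_prodList (by omega) h).2) k.1 ?_
  rw [← k.2, hw.prodList_inv l hl h]

theorem mem_append (hn : A.IsNormalSublocalGroup H V) (hw : A.IsCosetNhd V W) (l₁ l₂ : List G)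
    (hl : (l₁ ++ l₂).length ≤ 6) (hlW : ∀ a ∈ l₁ ++ l₂, a ∈ W) (h₁ : A.prodList l₁ ∈ H)
    (h₂ : A.prodList l₂ ∈ H) : A.prodList (l₁ ++ l₂) ∈ H := by
  have k := hw.prodList_append hl hlW
  have hV := (hw.represents_prodList hl hlW).2
  rw [k.2] at hV ⊢
  exact hn.mul_mem _ h₁ _ h₂ k.1 hV

theorem mem_inv (hn : A.IsNormalSublocalGroup H V) (hw : A.IsCosetNhd V W) (l : List G)
    (hl : l.length ≤ 3) (hlW : ∀ a ∈ l, a ∈ W) (h : A.prodList l ∈ H) :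
    A.prodList ((l.map A.inv).reverse) ∈ H := by
  have hV := (hw.represents_prodList (l := (l.map A.inv).reverse) (by simp; omega) (by
    intro a ha
    simp only [List.mem_reverse, List.mem_map] at ha
    obtain ⟨b, hb, rfl⟩ := ha
    exact hw.inv_mem (hlW b hb))).2
  rw [inv_prodList hn hw hl hlW] at hV ⊢
  exact hn.inv_mem _ h (hn.symm.1 (hn.subset h)) hV

theorem subset (hw : A.IsCosetNhd V W) : W ⊆ V := fun x hx => by
  have := (hw.represents_prodList (l := [x]) (by simp) (by simp [hx])).2
  rwa [prodList_single] at this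

theorem mem_conj (hn : A.IsNormalSublocalGroup H V) (hw : A.IsCosetNhd V W) {y : G} (l : List G)
    (hl : l.length ≤ 4) (hlW : ∀ a ∈ l, a ∈ W) (hy : y ∈ W) (h : A.prodList l ∈ H) :
    A.prodList (y :: (l ++ [A.inv y])) ∈ H := by
  have hy' := hw.inv_mem hy
  have hW : ∀ a ∈ y :: (l ++ [A.inv y]), a ∈ W := by
    intro a ha
    simp only [List.mem_cons, List.mem_append, List.not_mem_nil, or_false] at ha
    rcases ha with rfl | ha | rfl
    exacts [hy, hlW a ha, hy']
  have e1 := hw.prodList_append (l₁ := [y]) (l₂ := l ++ [A.inv y]) (by simp; omega) hW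
  have e2 := hw.prodList_append (l₁ := l) (l₂ := [A.inv y]) (by simp; omega)
    (fun a ha => hW a (List.mem_cons_of_mem _ ha))
  have e3 := hw.prodList_append (l₁ := y :: l) (l₂ := [A.inv y]) (by simp; omega) hW
  have e4 := hw.prodList_append (l₁ := [y]) (l₂ := l) (by simp; omega)
    (fun a ha => hW a (List.mem_append_left _ ha))
  have hV := (hw.represents_prodList (by simp; omega) hW).2
  refine hn.conj_mem y (hw.subset hy) _ h _ hV ?_
  rw [prodList_single] at e1 e2 e3 e4
  rw [Represents]
  intro i
  fin_cases i
  · refine ⟨y, A.mul (A.prodList l) (A.inv y), by simp [Represents], ?_, ?_, ?_⟩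
    · exact represents_pair e2.1
    · rw [← e2.2]; exact e1.1
    · rw [← e2.2]; exact e1.2.symm
  · refine ⟨A.mul y (A.prodList l), A.inv y, ?_, by simp [Represents], ?_, ?_⟩
    · exact represents_pair e4.1
    · rw [← e4.2]; exact e3.1
    · rw [← e4.2]; exact e3.2.symm

theorem rel_refl (hn : A.IsNormalSublocalGroup H V) (hw : A.IsCosetNhd V W) {x : G}
    (hx : x ∈ W) : A.mul (A.inv x) x ∈ H := by
  rw [A.inv_mul x (hw.symm.1 hx)]; exact hn.one_mem

theorem rel_symm (hn : A.IsNormalSublocalGroup H V) (hw : A.IsCosetNhd V W) {x y : G}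
    (hx : x ∈ W) (hy : y ∈ W) (h : A.mul (A.inv x) y ∈ H) : A.mul (A.inv y) x ∈ H := by
  rw [← prodList_pair] at h
  have := mem_inv hn hw [A.inv x, y] (by simp) (by simp [hw.inv_mem hx, hy]) h
  simpa [hw.inv_inv hx, prodList_pair] using this

theorem rel_trans (hn : A.IsNormalSublocalGroup H V) (hw : A.IsCosetNhd V W) {x y z : G}
    (hx : x ∈ W) (hy : y ∈ W) (hz : z ∈ W) (h : A.mul (A.inv x) y ∈ H)
    (h' : A.mul (A.inv y) z ∈ H) : A.mul (A.inv x) z ∈ H := by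
  rw [← prodList_pair] at h h' ⊢
  have hx' := hw.inv_mem hx
  have hy' := hw.inv_mem hy
  have := mem_append hn hw [A.inv x, y] [A.inv y, z] (by simp) (by simp [*]) h h'
  rwa [show [A.inv x, y] ++ [A.inv y, z] = [A.inv x] ++ y :: A.inv y :: [z] from rfl,
    hw.cancel _ _ (by simp) (by simp [*]) hy (by simp [*])] at this

theorem rel_inv (hn : A.IsNormalSublocalGroup H V) (hw : A.IsCosetNhd V W) {x y : G}
    (hx : x ∈ W) (hy : y ∈ W) (h : A.mul (A.inv x) y ∈ H) :
    A.mul (A.inv (A.inv x)) (A.inv y) ∈ H := by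
  have h' := rel_symm hn hw hx hy h
  have hy' := hw.inv_mem hy
  rw [hw.inv_inv hx]
  rw [← prodList_pair] at h' ⊢
  have := mem_conj hn hw [A.inv y, x] (by simp) (by simp [*]) hy h'
  rwa [show y :: ([A.inv y, x] ++ [A.inv y]) = [] ++ y :: A.inv y :: [x, A.inv y] from rfl,
    hw.cancel _ _ (by simp) (by simp [*]) hy (by simp [*])] at this

/-- If `x ~ x'` and `y ~ y'` then `y⁻¹x⁻¹x'y' ∈ H`. -/
theorem rel_mul_aux (hn : A.IsNormalSublocalGroup H V) (hw : A.IsCosetNhd V W) {x x' y y' : G}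
    (hx : x ∈ W) (hy : y ∈ W) (hx' : x' ∈ W) (hy' : y' ∈ W)
    (h : A.mul (A.inv x) x' ∈ H) (h' : A.mul (A.inv y) y' ∈ H) :
    A.prodList [A.inv y, A.inv x, x', y'] ∈ H := by
  have ix := hw.inv_mem hx
  have iy := hw.inv_mem hy
  rw [← prodList_pair] at h h'
  have k := mem_conj hn hw [A.inv x, x'] (by simp) (by simp [*]) iy h
  rw [hw.inv_inv hy] at k
  have := mem_append hn hw _ [A.inv y, y'] (by simp) (by simp [*]) k h'
  rwa [show A.inv y :: ([A.inv x, x'] ++ [y]) ++ [A.inv y, y'] =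
      [A.inv y, A.inv x, x'] ++ y :: A.inv y :: [y'] from rfl,
    hw.cancel _ _ (by simp) (by simp [*]) hy (by simp [*])] at this

theorem prodList_pair_inv (hn : A.IsNormalSublocalGroup H V) (hw : A.IsCosetNhd V W) {x y : G}
    (hx : x ∈ W) (hy : y ∈ W) :
    A.prodList [A.inv y, A.inv x] = A.prodList [A.inv (A.mul x y)] := by
  have := inv_prodList hn hw (l := [x, y]) (by simp) (by simp [*])
  rw [prodList_single, ← prodList_pair]
  exact this

theorem rel_mul (hn : A.IsNormalSublocalGroup H V) (hw : A.IsCosetNhd V W) {x x' y y' : G}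
    (hx : x ∈ W) (hy : y ∈ W) (hx' : x' ∈ W) (hy' : y' ∈ W) (hxy : A.mul x y ∈ W)
    (hxy' : A.mul x' y' ∈ W)
    (h : A.mul (A.inv x) x' ∈ H) (h' : A.mul (A.inv y) y' ∈ H) :
    A.mul (A.inv (A.mul x y)) (A.mul x' y') ∈ H := by
  have ix := hw.inv_mem hx
  have iy := hw.inv_mem hy
  have ixy := hw.inv_mem hxy
  have k := rel_mul_aux hn hw hx hy hx' hy' h h'
  have e1 := hw.prodList_congr [] [x', y'] (prodList_pair_inv hn hw hx hy)
    (by simp) (by simp [*]) (by simp) (by simp [*])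
  have e2 := hw.prodList_congr [A.inv (A.mul x y)] (m := [x', y']) (m' := [A.mul x' y']) []
    (by rw [prodList_pair, prodList_single]) (by simp) (by simp [*]) (by simp) (by simp [*])
  rw [← prodList_pair]
  exact e2 ▸ e1 ▸ k

theorem rel_assoc (hn : A.IsNormalSublocalGroup H V) (hw : A.IsCosetNhd V W)
    {x y y₁ z u z₁ x₁ v : G} (hx : x ∈ W) (hy : y ∈ W) (hy₁ : y₁ ∈ W) (hz : z ∈ W)
    (hu : u ∈ W) (hz₁ : z₁ ∈ W) (hx₁ : x₁ ∈ W) (hv : v ∈ W)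
    (hxy : A.mul x y ∈ W) (hyz : A.mul y₁ z ∈ W) (huz : A.mul u z₁ ∈ W) (hxv : A.mul x₁ v ∈ W)
    (hxx : A.mul (A.inv x) x₁ ∈ H) (hyy : A.mul (A.inv y) y₁ ∈ H) (hzz : A.mul (A.inv z) z₁ ∈ H)
    (huu : A.mul (A.inv u) (A.mul x y) ∈ H) (hvv : A.mul (A.inv v) (A.mul y₁ z) ∈ H) :
    A.mul (A.inv (A.mul u z₁)) (A.mul x₁ v) ∈ H := by
  have ix := hw.inv_mem hx
  have iy := hw.inv_mem hy
  have iy₁ := hw.inv_mem hy₁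
  have iz := hw.inv_mem hz
  have iz₁ := hw.inv_mem hz₁
  have iu := hw.inv_mem hu
  have iv := hw.inv_mem hv
  have ixy := hw.inv_mem hxy
  have iuz := hw.inv_mem huz
  rw [← prodList_pair] at hxx hyy hzz huu hvv
  -- `u⁻¹ x₁ y ∈ H`
  have k : A.prodList [A.inv u, x₁, y] ∈ H := by
    have c := mem_conj hn hw [A.inv x, x₁] (by simp) (by simp [*]) iy hxx
    rw [hw.inv_inv hy] at c
    have d := mem_append hn hw _ _ (by simp) (by simp [*]) huu c
    have e1 := hw.prodList_congr [A.inv u] (m := [A.mul x y]) (m' := [x, y])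
      [A.inv y, A.inv x, x₁, y] (by rw [prodList_pair, prodList_single])
    have e : A.prodList [A.mul x y, A.inv y] = A.prodList [x] := by
      have q := hw.cancel [x] (x := y) [] (by simp) (by simp [*]) hy (by simp)
      have q' := (hw.prodList_append (l₁ := [x, y]) (l₂ := [A.inv y]) (by simp) (by simp [*])).2
      rw [prodList_single, prodList_pair] at q'
      rw [prodList_pair, ← q']
      exact q
    have e2 := hw.prodList_congr [A.inv u] [A.inv x, x₁, y] e (by simp) (by simp [*])
      (by simp) (by simp [*])
    have e3 := hw.cancel [A.inv u] [x₁, y] (by simp) (by simp [*]) hx (by simp [*])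
    exact e3 ▸ e2 ▸ d
  -- `v⁻¹ y z₁ ∈ H`
  have n : A.prodList [A.inv v, y, z₁] ∈ H := by
    have c0 := mem_inv hn hw [A.inv y, y₁] (by simp) (by simp [*]) hyy
    simp only [List.map_cons, List.map_nil, List.reverse_cons, List.reverse_nil, List.nil_append,
      List.cons_append, hw.inv_inv hy] at c0
    have c := mem_conj hn hw _ (by simp) (by simp [*]) iz c0
    rw [hw.inv_inv hz] at c
    have c1 := mem_append hn hw _ _ (by simp) (by simp [*]) c hzz
    have c2 : A.prodList [A.inv z, A.inv y₁, y, z₁] ∈ H :=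
      hw.cancel [A.inv z, A.inv y₁, y] [z₁] (by simp) (by simp [*]) hz (by simp [*]) ▸ c1
    have d := mem_append hn hw _ _ (by simp) (by simp [*]) hvv c2
    have e : A.prodList [A.mul y₁ z, A.inv z] = A.prodList [y₁] := by
      have q := hw.cancel [y₁] (x := z) [] (by simp) (by simp [*]) hz (by simp)
      have q' := (hw.prodList_append (l₁ := [y₁, z]) (l₂ := [A.inv z]) (by simp) (by simp [*])).2
      rw [prodList_single, prodList_pair] at q'
      rw [prodList_pair, ← q']
      exact q
    have e2 := hw.prodList_congr [A.inv v] [A.inv y₁, y, z₁] e (by simp) (by simp [*])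
      (by simp) (by simp [*])
    have e3 := hw.cancel [A.inv v] [y, z₁] (by simp) (by simp [*]) hy₁ (by simp [*])
    exact e3 ▸ e2 ▸ d
  -- `y⁻¹ v z₁⁻¹ ∈ H`
  have n' : A.prodList [A.inv y, v, A.inv z₁] ∈ H := by
    have c := mem_inv hn hw _ (by simp) (by simp [*]) n
    simp only [List.map_cons, List.map_nil, List.reverse_cons, List.reverse_nil, List.nil_append,
      List.cons_append, hw.inv_inv hv] at c
    have d := mem_conj hn hw _ (by simp) (by simp [*]) hz₁ c
    exact hw.cancel [] [A.inv y, v, A.inv z₁] (by simp) (by simp [*]) hz₁ (by simp [*]) ▸ d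
  have c1 := mem_append hn hw _ _ (by simp) (by simp [*]) k n'
  have c2 : A.prodList [A.inv u, x₁, v, A.inv z₁] ∈ H :=
    hw.cancel [A.inv u, x₁] [v, A.inv z₁] (by simp) (by simp [*]) hy (by simp [*]) ▸ c1
  have c3 := mem_conj hn hw _ (by simp) (by simp [*]) iz₁ c2
  rw [hw.inv_inv hz₁] at c3
  have c4 : A.prodList [A.inv z₁, A.inv u, x₁, v] ∈ H :=
    hw.cancel' [A.inv z₁, A.inv u, x₁, v] [] (by simp) (by simp [*]) hz₁ (by simp [*]) ▸ c3
  have e1 := hw.prodList_congr [] [x₁, v] (prodList_pair_inv hn hw hu hz₁)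
    (by simp) (by simp [*]) (by simp) (by simp [*])
  have e2 := hw.prodList_congr [A.inv (A.mul u z₁)] (m := [x₁, v]) (m' := [A.mul x₁ v]) []
    (by rw [prodList_pair, prodList_single]) (by simp) (by simp [*]) (by simp) (by simp [*])
  rw [← prodList_pair]
  exact e2 ▸ e1 ▸ c4

end IsCosetNhd

/-- The relation `E_H` on `W`: `x ~ y` iff `x⁻¹y ∈ H`. -/
def cosetSetoid (hn : A.IsNormalSublocalGroup H V) (hw : A.IsCosetNhd V W) : Setoid W where
  r x y := A.mul (A.inv x) y ∈ H
  iseqv :=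
    { refl := fun x => IsCosetNhd.rel_refl hn hw x.2
      symm := fun {x y} h => IsCosetNhd.rel_symm hn hw x.2 y.2 h
      trans := fun {x y z} h h' => IsCosetNhd.rel_trans hn hw x.2 y.2 z.2 h h' }

/-- The space `W / E_H` of local cosets, with the quotient topology. -/
def CosetSpace (hn : A.IsNormalSublocalGroup H V) (hw : A.IsCosetNhd V W) : Type u :=
  Quotient (cosetSetoid hn hw)

instance instTopologicalSpaceCosetSpace (hn : A.IsNormalSublocalGroup H V) (hw : A.IsCosetNhd V W) :
    TopologicalSpace (CosetSpace hn hw) :=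
  inferInstanceAs (TopologicalSpace (Quotient (cosetSetoid hn hw)))

/-- The canonical map `W → W / E_H`. -/
def cosetMk (hn : A.IsNormalSublocalGroup H V) (hw : A.IsCosetNhd V W) (x : W) :
    CosetSpace hn hw :=
  Quotient.mk (cosetSetoid hn hw) x

theorem cosetMk_eq_iff (hn : A.IsNormalSublocalGroup H V) (hw : A.IsCosetNhd V W) {x y : W} :
    cosetMk hn hw x = cosetMk hn hw y ↔ A.mul (A.inv x) y ∈ H :=
  Quotient.eq (r := cosetSetoid hn hw)

theorem cosetMk_surjective (hn : A.IsNormalSublocalGroup H V) (hw : A.IsCosetNhd V W) :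
    Function.Surjective (cosetMk hn hw) := Quotient.mk_surjective

theorem continuous_cosetMk (hn : A.IsNormalSublocalGroup H V) (hw : A.IsCosetNhd V W) :
    Continuous (cosetMk hn hw) := continuous_quotient_mk'

theorem isOpenMap_cosetMk (hn : A.IsNormalSublocalGroup H V) (hw : A.IsCosetNhd V W) :
    IsOpenMap (cosetMk hn hw) := by
  intro O hO
  change IsOpen (cosetMk hn hw ⁻¹' _)
  rw [isOpen_iff_mem_nhds]
  rintro w ⟨x, hxO, hxw⟩
  have hx := x.2
  have hwW := w.2
  have iw := hw.inv_mem hwW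
  have hrel := (cosetMk_eq_iff hn hw).1 hxw.symm
  have key : ∀ w' ∈ W, (w', A.mul (A.inv w) x) ∈ A.mulDom ∧
      A.prodList [w', A.inv w, x] = A.mul w' (A.mul (A.inv w) x) := by
    intro w' hw'
    have := hw.prodList_append (l₁ := [w']) (l₂ := [A.inv w, (x : G)]) (by simp) (by simp [*])
    rwa [IsCosetNhd.prodList_single, IsCosetNhd.prodList_pair] at this
  have hval : A.mul (w : G) (A.mul (A.inv w) x) = x := by
    rw [← (key w hwW).2]
    exact (hw.cancel [] [(x : G)] (by simp) (by simp) hwW (by simp [*])).trans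
      (IsCosetNhd.prodList_single _)
  have hcont : ContinuousAt (fun w' : W => A.mul (w' : G) (A.mul (A.inv w) x)) w := by
    have h1 := A.continuousOn_mul.continuousAt (A.isOpen_mulDom.mem_nhds (key w hwW).1)
    exact ContinuousAt.comp (f := fun w' : W => ((w' : G), A.mul (A.inv w) (x : G))) h1
      (by fun_prop)
  have hOG : IsOpen ((↑) '' O : Set G) := hw.isOpen.isOpenMap_subtype_val O hO
  filter_upwards [hcont.preimage_mem_nhds (hOG.mem_nhds (by rw [hval]; exact ⟨x, hxO, rfl⟩))]
    with w' hw'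
  obtain ⟨o, ho, hoe⟩ := hw'
  refine ⟨o, ho, ?_⟩
  have h2 := w'.2
  have iw' := hw.inv_mem h2
  have ho' := o.2
  refine ((cosetMk_eq_iff hn hw).2 ?_).symm
  have e1 : A.prodList [(o : G)] = A.prodList [(w' : G), A.inv w, x] := by
    rw [IsCosetNhd.prodList_single, (key w' h2).2]; exact hoe
  have e2 := hw.prodList_congr [A.inv w'] [] e1 (by simp) (by simp [iw', ho']) (by simp)
    (by simp [iw', h2, iw, hx])
  have e3 := hw.cancel' [] (x := w') [A.inv w, (x : G)] (by simp) (by simp) h2 (by simp [*])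
  have e4 := e2.trans e3
  simp only [List.append_nil, List.nil_append, List.cons_append, IsCosetNhd.prodList_pair] at e4
  rw [e4]; exact hrel

theorem isOpenQuotientMap_cosetMk (hn : A.IsNormalSublocalGroup H V) (hw : A.IsCosetNhd V W) :
    IsOpenQuotientMap (cosetMk hn hw) :=
  ⟨cosetMk_surjective hn hw, continuous_cosetMk hn hw, isOpenMap_cosetMk hn hw⟩

theorem t2Space_cosetSpace (hn : A.IsNormalSublocalGroup H V) (hw : A.IsCosetNhd V W) :
    T2Space (CosetSpace hn hw) := by
  rw [t2Space_iff_of_isOpenQuotientMap (isOpenQuotientMap_cosetMk hn hw)]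
  have hV : ∀ p : W × W, A.mul (A.inv p.1) p.2 ∈ V := by
    intro p
    have := (hw.represents_prodList (l := [A.inv p.1, (p.2 : G)]) (by simp)
      (by simp [hw.inv_mem p.1.2])).2
    rwa [IsCosetNhd.prodList_pair] at this
  have hc : Continuous (fun p : W × W => A.mul (A.inv p.1) p.2) := by
    have hi : Continuous (fun x : W => A.inv x) :=
      A.continuousOn_inv.comp_continuous continuous_subtype_val (fun x => hw.symm.1 x.2)
    exact A.continuousOn_mul.comp_continuous
      (f := fun p : W × W => (A.inv (p.1 : G), (p.2 : G)))
      ((hi.comp continuous_fst).prodMk (continuous_subtype_val.comp continuous_snd))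
      (fun p => hw.mul_mem_dom (hw.inv_mem p.1.2) p.2.2)
  have := hn.isClosed.preimage (hc.subtype_mk hV)
  convert! this using 1
  ext p
  exact cosetMk_eq_iff hn hw

open Classical in
/-- The product of `G/H`: `[x][y] = [xy]` for representatives `x, y` with `xy ∈ W`. -/
noncomputable def cosetMul (hn : A.IsNormalSublocalGroup H V) (hw : A.IsCosetNhd V W)
    (a b : CosetSpace hn hw) : CosetSpace hn hw :=
  if h : ∃ p : W × W, cosetMk hn hw p.1 = a ∧ cosetMk hn hw p.2 = b ∧
      A.mul (p.1 : G) (p.2 : G) ∈ W then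
    cosetMk hn hw ⟨A.mul (h.choose.1 : G) (h.choose.2 : G), h.choose_spec.2.2⟩
  else cosetMk hn hw ⟨A.one, hw.one_mem⟩

theorem cosetMul_mk (hn : A.IsNormalSublocalGroup H V) (hw : A.IsCosetNhd V W) (x y : W)
    (hxy : A.mul (x : G) (y : G) ∈ W) :
    cosetMul hn hw (cosetMk hn hw x) (cosetMk hn hw y) = cosetMk hn hw ⟨A.mul x y, hxy⟩ := by
  have h : ∃ p : W × W, cosetMk hn hw p.1 = cosetMk hn hw x ∧
      cosetMk hn hw p.2 = cosetMk hn hw y ∧ A.mul (p.1 : G) (p.2 : G) ∈ W := ⟨(x, y), rfl, rfl, hxy⟩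
  rw [cosetMul, dif_pos h, cosetMk_eq_iff]
  have k := h.choose_spec
  exact IsCosetNhd.rel_mul hn hw h.choose.1.2 h.choose.2.2 x.2 y.2 k.2.2 hxy
    ((cosetMk_eq_iff hn hw).1 k.1) ((cosetMk_eq_iff hn hw).1 k.2.1)

/-- The inversion of `G/H`: `[x]⁻¹ = [x⁻¹]`. -/
def cosetInv (hn : A.IsNormalSublocalGroup H V) (hw : A.IsCosetNhd V W) :
    CosetSpace hn hw → CosetSpace hn hw :=
  Quotient.map (fun x : W => (⟨A.inv x, hw.inv_mem x.2⟩ : W))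
    (fun x y h => IsCosetNhd.rel_inv hn hw x.2 y.2 h)

theorem cosetInv_mk (hn : A.IsNormalSublocalGroup H V) (hw : A.IsCosetNhd V W) (x : W) :
    cosetInv hn hw (cosetMk hn hw x) = cosetMk hn hw ⟨A.inv x, hw.inv_mem x.2⟩ := rfl

/-- The local quotient group `(G/H)_W` on the space `W / E_H` of local cosets; its product
has domain `(π × π)((W × W) ∩ p⁻¹(W))`. -/
noncomputable def quotient (hn : A.IsNormalSublocalGroup H V) (hw : A.IsCosetNhd V W) :
    LocalGroup (CosetSpace hn hw) where
  t2 := t2Space_cosetSpace hn hw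
  one := cosetMk hn hw ⟨A.one, hw.one_mem⟩
  invDom := univ
  mulDom := Prod.map (cosetMk hn hw) (cosetMk hn hw) ''
    {p | ((p.1 : G), (p.2 : G)) ∈ A.mulDom ∧ A.mul (p.1 : G) (p.2 : G) ∈ W}
  inv := cosetInv hn hw
  mul := cosetMul hn hw
  isOpen_invDom := isOpen_univ
  isOpen_mulDom := by
    refine ((isOpenMap_cosetMk hn hw).prodMap (isOpenMap_cosetMk hn hw)) _ ?_
    exact (A.restrict W hw.isOpen hw.one_mem).isOpen_mulDom
  continuousOn_inv := by
    rw [continuousOn_univ, ← (isOpenQuotientMap_cosetMk hn hw).continuous_comp_iff]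
    refine (continuous_cosetMk hn hw).comp (Continuous.subtype_mk ?_ _)
    exact A.continuousOn_inv.comp_continuous continuous_subtype_val (fun x => hw.symm.1 x.2)
  continuousOn_mul := by
    rintro _ ⟨⟨x, y⟩, hxy, rfl⟩
    refine ContinuousAt.continuousWithinAt ?_
    rw [← ((isOpenQuotientMap_cosetMk hn hw).prodMap
      (isOpenQuotientMap_cosetMk hn hw)).continuousAt_comp_iff]
    have h1 := (A.restrict W hw.isOpen hw.one_mem).continuousOn_mul.continuousAt
      ((A.restrict W hw.isOpen hw.one_mem).isOpen_mulDom.mem_nhds (x := (x, y)) hxy)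
    refine ((continuous_cosetMk hn hw).continuousAt.comp h1).congr ?_
    filter_upwards [(A.restrict W hw.isOpen hw.one_mem).isOpen_mulDom.mem_nhds (x := (x, y)) hxy]
      with p hp
    change _ = cosetMul hn hw (cosetMk hn hw p.1) (cosetMk hn hw p.2)
    rw [cosetMul_mk hn hw _ _ hp.2]
    simp only [restrict, Function.comp_apply, dif_pos hp.2]
  one_mem_invDom := mem_univ _
  one_left_mem a := by
    obtain ⟨x, rfl⟩ := cosetMk_surjective hn hw a
    exact ⟨(⟨A.one, hw.one_mem⟩, x), ⟨A.one_left_mem _, by simp [A.one_mul]⟩, rfl⟩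
  one_right_mem a := by
    obtain ⟨x, rfl⟩ := cosetMk_surjective hn hw a
    exact ⟨(x, ⟨A.one, hw.one_mem⟩), ⟨A.one_right_mem _, by simp [A.mul_one]⟩, rfl⟩
  one_mul a := by
    obtain ⟨x, rfl⟩ := cosetMk_surjective hn hw a
    rw [cosetMul_mk hn hw _ _ (by simp [A.one_mul])]
    simp [A.one_mul]
  mul_one a := by
    obtain ⟨x, rfl⟩ := cosetMk_surjective hn hw a
    rw [cosetMul_mk hn hw _ _ (by simp [A.mul_one])]
    simp [A.mul_one]
  mul_inv_mem a _ := by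
    obtain ⟨x, rfl⟩ := cosetMk_surjective hn hw a
    have hx := hw.symm.1 x.2
    exact ⟨(x, ⟨A.inv x, hw.inv_mem x.2⟩), ⟨A.mul_inv_mem _ hx,
      by simp only [A.mul_inv _ hx, hw.one_mem]⟩, rfl⟩
  inv_mul_mem a _ := by
    obtain ⟨x, rfl⟩ := cosetMk_surjective hn hw a
    have hx := hw.symm.1 x.2
    exact ⟨(⟨A.inv x, hw.inv_mem x.2⟩, x), ⟨A.inv_mul_mem _ hx,
      by simp only [A.inv_mul _ hx, hw.one_mem]⟩, rfl⟩
  mul_inv a _ := by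
    obtain ⟨x, rfl⟩ := cosetMk_surjective hn hw a
    have hx := hw.symm.1 x.2
    rw [cosetInv_mk, cosetMul_mk hn hw _ _ (by simp only [A.mul_inv _ hx, hw.one_mem])]
    simp only [A.mul_inv _ hx]
  inv_mul a _ := by
    obtain ⟨x, rfl⟩ := cosetMk_surjective hn hw a
    have hx := hw.symm.1 x.2
    rw [cosetInv_mk, cosetMul_mk hn hw _ _ (by simp only [A.inv_mul _ hx, hw.one_mem])]
    simp only [A.inv_mul _ hx]
  assoc a b c := by
    rintro ⟨⟨x, y⟩, ⟨-, hxy⟩, h1⟩ ⟨⟨y₁, z⟩, ⟨-, hyz⟩, h2⟩ ⟨⟨u, z₁⟩, ⟨-, huz⟩, h3⟩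
      ⟨⟨x₁, v⟩, ⟨-, hxv⟩, h4⟩
    simp only [Prod.map_apply, Prod.mk.injEq] at h1 h2 h3 h4 hxy hyz huz hxv
    obtain ⟨rfl, rfl⟩ := h1
    obtain ⟨hy, rfl⟩ := h2
    obtain ⟨hu, hz⟩ := h3
    obtain ⟨hx, hv⟩ := h4
    have hu' := hu
    have hv' := hv
    rw [cosetMul_mk hn hw _ _ hxy] at hu'
    rw [← hy, cosetMul_mk hn hw _ _ hyz] at hv'
    rw [← hu, ← hv, ← hz, ← hx, cosetMul_mk hn hw _ _ huz, cosetMul_mk hn hw _ _ hxv]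
    rw [cosetMk_eq_iff] at hu' hv' hx hy hz ⊢
    exact IsCosetNhd.rel_assoc hn hw x.2 y.2 y₁.2 z.2 u.2 z₁.2 x₁.2 v.2 hxy hyz huz hxv
      (IsCosetNhd.rel_symm hn hw x₁.2 x.2 hx) (IsCosetNhd.rel_symm hn hw y₁.2 y.2 hy)
      (IsCosetNhd.rel_symm hn hw z₁.2 z.2 hz) hu' hv'

end Coset

section Morphisms

variable {G : Type u} [TopologicalSpace G] {G' : Type v} [TopologicalSpace G']

/-- A morphism of local groups. -/
structure Morphism (A : LocalGroup G) (B : LocalGroup G') where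
  toFun : G → G'
  continuous_toFun : Continuous toFun
  map_one : toFun A.one = B.one
  map_invDom : ∀ x ∈ A.invDom, toFun x ∈ B.invDom
  map_mulDom : ∀ x y, (x, y) ∈ A.mulDom → (toFun x, toFun y) ∈ B.mulDom
  map_inv : ∀ x ∈ A.invDom, toFun (A.inv x) = B.inv (toFun x)
  map_mul : ∀ x y, (x, y) ∈ A.mulDom → toFun (A.mul x y) = B.mul (toFun x) (toFun y)

/-- A morphism `G|U → G'` on the restriction of `G` to an open neighbourhood `U` of `1`. -/
structure PartialMorphism (A : LocalGroup G) (B : LocalGroup G') where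
  nhd : Set G
  isOpen : IsOpen nhd
  one_mem : A.one ∈ nhd
  hom : Morphism (A.restrict nhd isOpen one_mem) B

/-- Two morphisms `G|U₁ → G'` and `G|U₂ → G'` are equivalent if they agree on an open neighbourhood
`U₃ ⊆ U₁ ∩ U₂` of `1`. -/
def partialMorphismSetoid (A : LocalGroup G) (B : LocalGroup G') :
    Setoid (PartialMorphism A B) where
  r f g := ∃ U : Set G, IsOpen U ∧ A.one ∈ U ∧ ∃ (hf : U ⊆ f.nhd) (hg : U ⊆ g.nhd),
    ∀ (x : G) (hx : x ∈ U), f.hom.toFun ⟨x, hf hx⟩ = g.hom.toFun ⟨x, hg hx⟩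
  iseqv :=
    { refl := fun f => ⟨f.nhd, f.isOpen, f.one_mem, subset_rfl, subset_rfl, fun _ _ => rfl⟩
      symm := fun ⟨U, hU, h1, hf, hg, h⟩ => ⟨U, hU, h1, hg, hf, fun x hx => (h x hx).symm⟩
      trans := fun ⟨U, hU, h1, hf, _, h⟩ ⟨U', hU', h1', _, hg', h'⟩ =>
        ⟨U ∩ U', hU.inter hU', ⟨h1, h1'⟩, fun _ hx => hf hx.1, fun _ hx => hg' hx.2,
          fun x hx => (h x hx.1).trans (h' x hx.2)⟩ }

/-- Local morphisms from `G` to `G'`. -/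
def LocalMorphism (A : LocalGroup G) (B : LocalGroup G') : Type (max u v) :=
  Quotient (partialMorphismSetoid A B)

/-- A local 1-parameter subgroup `X : (-r, r) → G` with `r ∈ (0, ∞]`. It is represented by a
total function, whose values outside `(-r, r)` are never used. -/
structure LocalOnePS (A : LocalGroup G) where
  radius : EReal
  radius_pos : 0 < radius
  toFun : ℝ → G
  continuousOn : ContinuousOn toFun {t : ℝ | ((|t| : ℝ) : EReal) < radius}
  mem_invDom : ∀ t : ℝ, ((|t| : ℝ) : EReal) < radius → toFun t ∈ A.invDom
  map_add : ∀ s t : ℝ, ((|s| : ℝ) : EReal) < radius → ((|t| : ℝ) : EReal) < radius →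
    ((|s + t| : ℝ) : EReal) < radius →
    (toFun s, toFun t) ∈ A.mulDom ∧ toFun (s + t) = A.mul (toFun s) (toFun t)

/-- `X` and `Y` are equivalent if there is `r > 0` with `r ∈ domain X ∩ domain Y` such that
`X` and `Y` agree on `(-r, r)`. -/
def localOnePSSetoid (A : LocalGroup G) : Setoid (LocalOnePS A) where
  r X Y := ∃ r : ℝ, 0 < r ∧ (r : EReal) < X.radius ∧ (r : EReal) < Y.radius ∧
    EqOn X.toFun Y.toFun (Ioo (-r) r)
  iseqv :=
    { refl := fun X => by
        obtain ⟨r, h0, hr⟩ := EReal.lt_iff_exists_real_btwn.1 X.radius_pos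
        exact ⟨r, by exact_mod_cast h0, hr, hr, fun _ _ => rfl⟩
      symm := fun ⟨r, h0, h1, h2, h⟩ => ⟨r, h0, h2, h1, h.symm⟩
      trans := fun {X Y Z} ⟨r, h0, h1, h2, h⟩ ⟨r', h0', h1', h2', h'⟩ => by
        refine ⟨min r r', lt_min h0 h0', ?_, ?_, fun t ht => ?_⟩
        · exact lt_of_le_of_lt (by exact_mod_cast min_le_left r r') h1
        · exact lt_of_le_of_lt (by exact_mod_cast min_le_right r r') h2'
        · have := min_le_left r r'
          have := min_le_right r r'
          exact (h ⟨by linarith [ht.1], by linarith [ht.2]⟩).trans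
            (h' ⟨by linarith [ht.1], by linarith [ht.2]⟩) }

/-- `L(G)`: the set of germs at `0` of local 1-parameter subgroups of `G`. -/
def L (A : LocalGroup G) : Type u := Quotient (localOnePSSetoid A)

theorem LocalOnePS.map_zero {A : LocalGroup G} (X : LocalOnePS A) : X.toFun 0 = A.one := by
  have h0 : ((|(0 : ℝ)| : ℝ) : EReal) < X.radius := by simpa using X.radius_pos
  have hi := X.mem_invDom 0 h0
  have h := X.map_add 0 0 h0 h0 (by simpa using X.radius_pos)
  rw [add_zero] at h
  have k := A.assoc (A.inv (X.toFun 0)) (X.toFun 0) (X.toFun 0) (A.inv_mul_mem _ hi) h.1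
    (by rw [A.inv_mul _ hi]; exact A.one_left_mem _)
    (by rw [← h.2]; exact A.inv_mul_mem _ hi)
  rwa [← h.2, A.inv_mul _ hi, A.one_mul] at k

theorem LocalOnePS.map_neg {A : LocalGroup G} (X : LocalOnePS A) {t : ℝ}
    (ht : ((|t| : ℝ) : EReal) < X.radius) : X.toFun (-t) = A.inv (X.toFun t) := by
  have h := X.map_add t (-t) ht (by simpa using ht) (by simpa using X.radius_pos)
  rw [add_neg_cancel, X.map_zero] at h
  exact A.eq_inv_of_mul_eq_one (X.mem_invDom t ht) h.1 h.2.symm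

theorem LocalOnePS.exists_radius {A : LocalGroup G} (X : LocalOnePS A) {U : Set G}
    (hU : IsOpen U) (h1 : A.one ∈ U) :
    ∃ ε : ℝ, 0 < ε ∧ (ε : EReal) < X.radius ∧ ∀ t : ℝ, |t| < ε → X.toFun t ∈ U := by
  obtain ⟨r, h0, hr⟩ := EReal.lt_iff_exists_real_btwn.1 X.radius_pos
  have h0' : 0 < r := by exact_mod_cast h0
  have hc : ContinuousAt X.toFun 0 := by
    refine X.continuousOn.continuousAt (Filter.mem_of_superset (Metric.ball_mem_nhds 0 h0') ?_)
    intro t ht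
    rw [mem_ball_zero_iff, Real.norm_eq_abs] at ht
    exact lt_trans (by exact_mod_cast ht) hr
  obtain ⟨δ, hδ, h⟩ := Metric.mem_nhds_iff.1
    (hc.preimage_mem_nhds (hU.mem_nhds (by rw [X.map_zero]; exact h1)))
  refine ⟨min r δ, lt_min h0' hδ, lt_of_le_of_lt (by exact_mod_cast min_le_left r δ) hr, ?_⟩
  intro t ht
  exact h (by simpa using lt_of_lt_of_le ht (min_le_right r δ))

open Classical in
/-- The composition `f ∘ X` of a local 1-parameter subgroup `X` of `G` with a morphism
`f : G|U → G'`, where `X` is first restricted to an interval `(-ε, ε)` which it maps into `U`. -/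
noncomputable def PartialMorphism.comp {A : LocalGroup G} {B : LocalGroup G'}
    (f : PartialMorphism A B) (X : LocalOnePS A) : LocalOnePS B where
  radius := ((X.exists_radius f.isOpen f.one_mem).choose : ℝ)
  radius_pos := by exact_mod_cast (X.exists_radius f.isOpen f.one_mem).choose_spec.1
  toFun t := if h : X.toFun t ∈ f.nhd then f.hom.toFun ⟨X.toFun t, h⟩ else B.one
  continuousOn := by
    have k := (X.exists_radius f.isOpen f.one_mem).choose_spec
    rw [continuousOn_iff_continuous_domRestrict]
    have hU : ∀ t : {t : ℝ | ((|t| : ℝ) : EReal) <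
        ((X.exists_radius f.isOpen f.one_mem).choose : ℝ)}, X.toFun t ∈ f.nhd :=
      fun t => k.2.2 t (by exact_mod_cast t.2)
    have hc : Continuous (fun t : {t : ℝ | ((|t| : ℝ) : EReal) <
        ((X.exists_radius f.isOpen f.one_mem).choose : ℝ)} => X.toFun t) :=
      X.continuousOn.comp_continuous continuous_subtype_val (fun t => lt_trans t.2 k.2.1)
    refine (f.hom.continuous_toFun.comp (hc.subtype_mk hU)).congr ?_
    intro t
    simp only [Function.comp_apply, Set.domRestrict_apply, dif_pos (hU t)]
  mem_invDom t ht := by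
    have k := (X.exists_radius f.isOpen f.one_mem).choose_spec
    have ht' : |t| < (X.exists_radius f.isOpen f.one_mem).choose := by exact_mod_cast ht
    have hX := lt_trans ht k.2.1
    have hU := k.2.2 t ht'
    rw [dif_pos hU]
    refine f.hom.map_invDom _ ⟨X.mem_invDom t hX, ?_⟩
    change A.inv (X.toFun t) ∈ f.nhd
    rw [← X.map_neg hX]
    exact k.2.2 _ (by rwa [abs_neg])
  map_add s t hs ht hst := by
    have k := (X.exists_radius f.isOpen f.one_mem).choose_spec
    have hs' : |s| < (X.exists_radius f.isOpen f.one_mem).choose := by exact_mod_cast hs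
    have ht' : |t| < (X.exists_radius f.isOpen f.one_mem).choose := by exact_mod_cast ht
    have hst' : |s + t| < (X.exists_radius f.isOpen f.one_mem).choose := by exact_mod_cast hst
    have hX := X.map_add s t (lt_trans hs k.2.1) (lt_trans ht k.2.1) (lt_trans hst k.2.1)
    have hUs := k.2.2 s hs'
    have hUt := k.2.2 t ht'
    have hUst := k.2.2 _ hst'
    have hUst' := hUst
    rw [hX.2] at hUst'
    have hd : ((⟨X.toFun s, hUs⟩ : f.nhd), (⟨X.toFun t, hUt⟩ : f.nhd)) ∈
      (A.restrict f.nhd f.isOpen f.one_mem).mulDom := ⟨hX.1, hUst'⟩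
    rw [dif_pos hUs, dif_pos hUt, dif_pos hUst]
    refine ⟨f.hom.map_mulDom _ _ hd, ?_⟩
    rw [← f.hom.map_mul _ _ hd]
    congr 1
    simp only [LocalGroup.restrict, dif_pos hUst', hX.2]

theorem PartialMorphism.comp_equiv {A : LocalGroup G} {B : LocalGroup G'}
    {f g : PartialMorphism A B} {X Y : LocalOnePS A} (hfg : (partialMorphismSetoid A B).r f g)
    (hXY : (localOnePSSetoid A).r X Y) : (localOnePSSetoid B).r (f.comp X) (g.comp Y) := by
  obtain ⟨U, hU, h1, hf, hg, h⟩ := hfg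
  obtain ⟨r, h0, hrX, hrY, hr⟩ := hXY
  obtain ⟨ε, hε, hεX, hεU⟩ := X.exists_radius hU h1
  obtain ⟨a, ha0, ha⟩ := EReal.lt_iff_exists_real_btwn.1 (f.comp X).radius_pos
  obtain ⟨b, hb0, hb⟩ := EReal.lt_iff_exists_real_btwn.1 (g.comp Y).radius_pos
  have ha0' : 0 < a := by exact_mod_cast ha0
  have hb0' : 0 < b := by exact_mod_cast hb0
  refine ⟨min (min r ε) (min a b), by simp [*], ?_, ?_, ?_⟩
  · exact lt_of_le_of_lt (by exact_mod_cast (min_le_right _ _).trans (min_le_left a b)) ha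
  · exact lt_of_le_of_lt (by exact_mod_cast (min_le_right _ _).trans (min_le_right a b)) hb
  · intro t ht
    have ht' := abs_lt.2 ht
    have e : X.toFun t = Y.toFun t :=
      hr (abs_lt.1 (ht'.trans_le ((min_le_left _ _).trans (min_le_left _ _))))
    have hUt := hεU t (ht'.trans_le ((min_le_left _ _).trans (min_le_right _ _)))
    have hUt' := hUt
    rw [e] at hUt'
    simp only [PartialMorphism.comp, dif_pos (hf hUt), dif_pos (hg hUt')]
    rw [h _ hUt]
    congr 2

/-- The map `L(f) : L(G) → L(G')` induced by a local morphism `f`, `L(f)([X]) = [f ∘ X]`. -/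
noncomputable def LocalMorphism.mapL {A : LocalGroup G} {B : LocalGroup G'}
    (f : LocalMorphism A B) : L A → L B :=
  Quotient.map₂ (sa := partialMorphismSetoid A B) (sb := localOnePSSetoid A)
    (sc := localOnePSSetoid B) PartialMorphism.comp
    (fun _ _ hfg _ _ hXY => PartialMorphism.comp_equiv hfg hXY) f

end Morphisms

section Projection

variable {G : Type u} [TopologicalSpace G] {A : LocalGroup G} {H V W : Set G}

/-- The canonical map `W → W / E_H` as a morphism `G|W → (G/H)_W`. -/
noncomputable def projHom (hn : A.IsNormalSublocalGroup H V) (hw : A.IsCosetNhd V W) :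
    Morphism (A.restrict W hw.isOpen hw.one_mem) (quotient hn hw) where
  toFun := cosetMk hn hw
  continuous_toFun := continuous_cosetMk hn hw
  map_one := rfl
  map_invDom _ _ := mem_univ _
  map_mulDom x y h := ⟨(x, y), h, rfl⟩
  map_inv x h := by
    change _ = cosetInv hn hw (cosetMk hn hw x)
    simp only [cosetInv_mk, restrict, dif_pos h.2]
  map_mul x y h := by
    change _ = cosetMul hn hw (cosetMk hn hw x) (cosetMk hn hw y)
    rw [cosetMul_mk hn hw _ _ h.2]
    simp only [restrict, dif_pos h.2]

/-- The canonical projection `π : G → G/H`, the local morphism represented by the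
morphism `G|W → (G/H)_W`. -/
noncomputable def proj (hn : A.IsNormalSublocalGroup H V) (hw : A.IsCosetNhd V W) :
    LocalMorphism A (quotient hn hw) :=
  Quotient.mk (partialMorphismSetoid A (quotient hn hw))
    ⟨W, hw.isOpen, hw.one_mem, projHom hn hw⟩

end Projection

end LocalGroup

/-! The lift is built from approximate roots: choose `x` near `1` over `Y δ` for small `δ > 0`,
follow the powers `x ^ i` as approximations to the lift at time `i * δ`, and let `δ` tend to `0`.
The danger is that the powers drift away along `H`, which is invisible in the quotient.

Total disconnectedness prevents this. It gives arbitrarily small compact neighbourhoods `K` of `1`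
whose part outside `interior K` misses `H` (`exists_isCompact_inter_subset_interior`). The image of
`K \ interior K` in `G/H` is then compact and misses the identity, so `Y t` avoids it for small `t`.
Hence the points of `K` over a short arc of `Y` form a compact subset of `interior K`, and
multiplying them by an element close enough to `1` stays in `K`. By induction all powers of a good
`x` remain in `K` as long as `i * δ ≤ ε` (`exists_npow_mem`).

Compactness of `K` yields limits `Z t` of `x ^ ⌊t / δ⌋` along an ultrafilter of pairs `(δ, x)`
tending to `(0, 1)` (`exists_lift_nonneg`). They lie over `Y t`; they are additive in `t` because
the floor is additive up to one extra factor `x`, which tends to `1`; and they tend to `1` as `t`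
does to `0`, because `K` can be taken arbitrarily small. Inversion extends `Z` to negative times,
and continuity at `0` propagates by multiplicativity (`exists_localOnePS_of_nonneg`). -/

namespace LocalGroup

open Filter

variable {G : Type u} [TopologicalSpace G] {A : LocalGroup G} {H V W : Set G}

/-! ### Powers and cancellation inside `W` -/

/-- The left-normed power `(⋯(x x)⋯)x` with `n` factors. -/
def npow (A : LocalGroup G) (x : G) : ℕ → G
  | 0 => A.one
  | n + 1 => A.mul (A.npow x n) x

/-- Associativity is only conditional, so every intermediate power is required to lie in `W`; any
two elements of `W` can be multiplied, which supplies all four domain conditions. -/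
theorem npow_add (hw : A.IsCosetNhd V W) {x : G} (hx : x ∈ W) {n : ℕ}
    (h : ∀ i ≤ n, A.npow x i ∈ W) (i j : ℕ) (hij : i + j ≤ n) :
    A.npow x (i + j) = A.mul (A.npow x i) (A.npow x j) := by
  induction j with
  | zero => exact (A.mul_one _).symm
  | succ j ih =>
    have e := ih (by omega)
    have hi := h i (by omega)
    have hj := h j (by omega)
    change A.mul (A.npow x (i + j)) x = A.mul (A.npow x i) (A.mul (A.npow x j) x)
    rw [e]
    refine A.assoc _ _ _ (hw.mul_mem_dom hi hj) (hw.mul_mem_dom hj hx) ?_ ?_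
    · rw [← e]
      exact hw.mul_mem_dom (h _ (by omega)) hx
    · exact hw.mul_mem_dom hi (h (j + 1) (by omega))

theorem IsCosetNhd.eq_mul_inv (hw : A.IsCosetNhd V W) {a b c : G} (ha : a ∈ W) (hb : b ∈ W)
    (hc : c ∈ W) (h : c = A.mul a b) : a = A.mul c (A.inv b) := by
  have e := A.mul_inv b (hw.symm.1 hb)
  rw [h, A.assoc _ _ _ (hw.mul_mem_dom ha hb) (hw.mul_mem_dom hb (hw.inv_mem hb))
    (h ▸ hw.mul_mem_dom hc (hw.inv_mem hb)) (by rw [e]; exact A.one_right_mem a), e, A.mul_one]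

theorem IsCosetNhd.eq_inv_mul (hw : A.IsCosetNhd V W) {a b c : G} (ha : a ∈ W) (hb : b ∈ W)
    (hc : c ∈ W) (h : c = A.mul a b) : b = A.mul (A.inv a) c := by
  have e := A.inv_mul a (hw.symm.1 ha)
  rw [h, ← A.assoc _ _ _ (hw.mul_mem_dom (hw.inv_mem ha) ha) (hw.mul_mem_dom ha hb)
    (by rw [e]; exact A.one_left_mem b) (h ▸ hw.mul_mem_dom (hw.inv_mem ha) hc), e, A.one_mul]

/-- Cancelling three times: `b = a⁻¹c`, hence `a⁻¹ = bc⁻¹`, hence `c⁻¹ = b⁻¹a⁻¹`. -/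
theorem IsCosetNhd.inv_mul_rev (hw : A.IsCosetNhd V W) {a b c : G} (ha : a ∈ W) (hb : b ∈ W)
    (hc : c ∈ W) (h : c = A.mul a b) : A.inv c = A.mul (A.inv b) (A.inv a) := by
  have ha' := hw.inv_mem ha
  have hc' := hw.inv_mem hc
  have e : A.inv a = A.mul b (A.inv c) :=
    hw.eq_mul_inv ha' hc hb (hw.eq_inv_mul ha hb hc h)
  exact hw.eq_inv_mul hb hc' ha' e

/-! ### Trapping powers in a compact neighbourhood -/

/-- A compact neighbourhood of `1` whose frontier avoids the totally disconnected set `H`. -/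
theorem exists_isCompact_inter_subset_interior [LocallyCompactSpace G]
    (hn : A.IsNormalSublocalGroup H V) (hw : A.IsCosetNhd V W) (htd : IsTotallyDisconnected H)
    {P : Set G} (hP : P ∈ 𝓝 A.one) :
    ∃ K : Set G, IsCompact K ∧ K ⊆ W ∩ P ∧ A.one ∈ interior K ∧ K ∩ H ⊆ interior K := by
  have := A.t2
  obtain ⟨C, hC1, hCWP, hC⟩ := local_compact_nhds
    (inter_mem (hw.isOpen.mem_nhds hw.one_mem) hP)
  have hCV : C ⊆ V := fun x hx => hw.subset (hCWP hx).1
  have hCH : IsCompact (C ∩ H) := by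
    have h1 : IsCompact ((↑) ⁻¹' C : Set V) :=
      IsInducing.subtypeVal.isCompact_preimage_iff (by simpa using hCV) |>.2 hC
    have h2 := (h1.inter_right hn.isClosed).image continuous_subtype_val
    convert! h2 using 1
    rw [← preimage_inter, Subtype.image_preimage_coe]
    ext x
    exact ⟨fun h => ⟨hCV h.1, h⟩, fun h => h.2⟩
  have : CompactSpace (C ∩ H : Set G) := isCompact_iff_compactSpace.1 hCH
  have : TotallyDisconnectedSpace (C ∩ H : Set G) :=
    totallyDisconnectedSpace_subtype_iff.2 fun t ht => htd t (ht.trans inter_subset_right)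
  have h1C : A.one ∈ interior C := mem_interior_iff_mem_nhds.2 hC1
  -- A compact totally disconnected Hausdorff space has a basis of clopen sets. Both `F` and its
  -- complement in `C ∩ H` are therefore compact in `G`.
  obtain ⟨F, hF, h1F, hFC⟩ := compact_exists_isClopen_in_isOpen
    (X := (C ∩ H : Set G)) (isOpen_interior.preimage continuous_subtype_val)
    (show (⟨A.one, interior_subset h1C, hn.one_mem⟩ : (C ∩ H : Set G)) ∈ _ ⁻¹' interior C from h1C)
  have hF1 : IsCompact ((↑) '' F : Set G) := hF.isClosed.isCompact.image continuous_subtype_val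
  have hF2 : IsCompact ((↑) '' Fᶜ : Set G) :=
    hF.compl.isClosed.isCompact.image continuous_subtype_val
  -- `K` contains `F` in its interior and misses the rest of `C ∩ H`, so `K ∩ H` is exactly `F`.
  obtain ⟨K, hK, hFK, hKU⟩ := exists_compact_between hF1
    (isOpen_interior.inter hF2.isClosed.isOpen_compl) (U := interior C ∩ ((↑) '' Fᶜ)ᶜ) (by
      rintro _ ⟨x, hx, rfl⟩
      refine ⟨hFC hx, ?_⟩
      rintro ⟨y, hy, hyx⟩
      exact hy (Subtype.ext hyx ▸ hx))
  refine ⟨K, hK, fun x hx => hCWP (interior_subset (hKU hx).1), hFK ⟨_, h1F, rfl⟩, ?_⟩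
  rintro x ⟨hxK, hxH⟩
  by_contra hx
  have hxC : x ∈ C ∩ H := ⟨interior_subset (hKU hxK).1, hxH⟩
  exact (hKU hxK).2 ⟨⟨x, hxC⟩, fun h => hx (hFK ⟨_, h, rfl⟩), rfl⟩

theorem LocalOnePS.abs_lt_radius {B : LocalGroup G} {Y : LocalOnePS B} {ε t : ℝ}
    (hε : (ε : EReal) < Y.radius) (ht : |t| ≤ ε) : ((|t| : ℝ) : EReal) < Y.radius :=
  lt_of_le_of_lt (by exact_mod_cast ht) hε

theorem LocalOnePS.continuousAt {B : LocalGroup G} {Y : LocalOnePS B} {t : ℝ}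
    (ht : ((|t| : ℝ) : EReal) < Y.radius) : ContinuousAt Y.toFun t := by
  obtain ⟨r, h0, hr⟩ := EReal.lt_iff_exists_real_btwn.1 ht
  have h0' : |t| < r := by exact_mod_cast h0
  refine Y.continuousOn.continuousAt (mem_of_superset
    ((isOpen_lt continuous_abs continuous_const).mem_nhds h0') fun s hs => ?_)
  exact lt_trans (by exact_mod_cast (show |s| < r from hs)) hr

/-- Powers of lifts of `Y δ` which are close to `1` stay in a prescribed neighbourhood of `1`. -/
theorem exists_npow_mem [LocallyCompactSpace G]
    (hn : A.IsNormalSublocalGroup H V) (hw : A.IsCosetNhd V W) (htd : IsTotallyDisconnected H)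
    (Y : LocalOnePS (quotient hn hw)) {P : Set G} (hP : P ∈ 𝓝 A.one) :
    ∃ ε : ℝ, 0 < ε ∧ (ε : EReal) < Y.radius ∧ ∃ K : Set G, IsCompact K ∧ K ⊆ W ∩ P ∧
      ∃ N ∈ 𝓝 A.one, ∀ δ : ℝ, 0 < δ → ∀ x : W, (x : G) ∈ N → cosetMk hn hw x = Y.toFun δ →
        ∀ i : ℕ, i * δ ≤ ε → ∃ w : W, (w : G) = A.npow x i ∧ (w : G) ∈ K ∧
          cosetMk hn hw w = Y.toFun (i * δ) := by
  have := A.t2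
  have := t2Space_cosetSpace hn hw
  obtain ⟨K, hK, hKP, h1K, hKH⟩ := exists_isCompact_inter_subset_interior hn hw htd hP
  have hKW : IsCompact ((↑) ⁻¹' K : Set W) :=
    IsInducing.subtypeVal.isCompact_preimage_iff (by simpa using hKP.trans inter_subset_left) |>.2 hK
  have hfr : IsCompact (cosetMk hn hw '' ((↑) ⁻¹' (K \ interior K) : Set W)) := by
    refine IsCompact.image ?_ (continuous_cosetMk hn hw)
    exact hKW.diff (isOpen_interior.preimage continuous_subtype_val)
  -- A point over the identity of `G/H` lies in `H`, and `K ∩ H ⊆ interior K`; so the image of `K \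
  -- interior K` is a closed set missing the identity, and `Y` avoids it near `0`.
  obtain ⟨ε', hε', hεr', hY⟩ := Y.exists_radius hfr.isClosed.isOpen_compl (by
    rintro ⟨x, hx, hx1⟩
    refine hx.2 (hKH ⟨hx.1, ?_⟩)
    have := (cosetMk_eq_iff hn hw).1 hx1.symm
    rwa [A.inv_one, A.one_mul] at this)
  -- Halving gives a closed time interval, whose image under `Y` is compact, inside the open one
  -- where `hY` holds.
  have hε : 0 < ε' / 2 := half_pos hε'
  have hεr : ((ε' / 2 : ℝ) : EReal) < Y.radius :=
    lt_trans (by exact_mod_cast half_lt_self hε') hεr'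
  have hd : ∀ {t : ℝ}, t ∈ Icc 0 (ε' / 2) → ((|t| : ℝ) : EReal) < Y.radius := fun ht =>
    Y.abs_lt_radius hεr (by rw [abs_of_nonneg ht.1]; exact ht.2)
  have hS : IsCompact (Y.toFun '' Icc 0 (ε' / 2)) :=
    isCompact_Icc.image_of_continuousOn (fun t ht =>
      (LocalOnePS.continuousAt (hd ht)).continuousWithinAt)
  -- The points of `K` over the arc `Y [0, ε'/2]`: by the choice of `ε'` none of them lies outside
  -- `interior K`.
  set T : Set G := (↑) '' (((↑) ⁻¹' K : Set W) ∩ cosetMk hn hw ⁻¹' (Y.toFun '' Icc 0 (ε' / 2)))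
  have hT : IsCompact T := (hKW.inter_right
    (hS.isClosed.preimage (continuous_cosetMk hn hw))).image continuous_subtype_val
  have hTK : ∀ x ∈ T, x ∈ interior K := by
    rintro _ ⟨x, ⟨hxK, t, ht, hxt⟩, rfl⟩
    by_contra hx
    exact hY t (by rw [abs_of_nonneg ht.1]; linarith [ht.2]) (hxt ▸ ⟨x, ⟨hxK, hx⟩, rfl⟩)
  -- By compactness of `T` a single `N` satisfies `T · N ⊆ interior K`; it is chosen before `δ` and
  -- `x`.
  obtain ⟨U, N, hU, hN, hTU, h1N, hUN⟩ := generalized_tube_lemma hT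
    (isCompact_singleton (x := A.one))
    (A.continuousOn_mul.isOpen_inter_preimage A.isOpen_mulDom (isOpen_interior (s := K))) (by
      rintro ⟨x, y⟩ ⟨hx, hy⟩
      obtain rfl : y = A.one := hy
      exact ⟨A.one_right_mem x, by simpa [A.mul_one] using hTK x hx⟩)
  refine ⟨ε' / 2, hε, hεr, K, hK, hKP, N, hN.mem_nhds (h1N rfl), ?_⟩
  intro δ hδ x hxN hx i
  induction i with
  | zero =>
    intro _
    refine ⟨⟨A.one, hw.one_mem⟩, rfl, interior_subset h1K, ?_⟩
    simp only [Nat.cast_zero, zero_mul]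
    exact Y.map_zero.symm
  | succ i ih =>
    intro hi
    push_cast at hi ⊢
    have h0 : 0 ≤ i * δ := by positivity
    have hi' : i * δ ∈ Icc 0 (ε' / 2) := ⟨h0, by linarith⟩
    have e1 : (i + 1) * δ = i * δ + δ := by ring
    obtain ⟨w, hwi, hwK, hwY⟩ := ih hi'.2
    -- The current power lies in `K` over the arc, hence in `T`, so one more factor from `N` cannot
    -- leave `K`.
    have hm : A.mul (w : G) x ∈ interior K :=
      (hUN (show ((w : G), (x : G)) ∈ U ×ˢ N from
        ⟨hTU ⟨w, ⟨hwK, _, hi', hwY.symm⟩, rfl⟩, hxN⟩)).2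
    have hmW : A.mul (w : G) x ∈ W := (hKP (interior_subset hm)).1
    refine ⟨⟨A.mul w x, hmW⟩, congrArg (A.mul · (x : G)) hwi, interior_subset hm, ?_⟩
    rw [← cosetMul_mk hn hw w x hmW, hwY, hx, e1]
    exact (Y.map_add _ _ (hd hi') (hd ⟨hδ.le, by linarith⟩)
      (hd ⟨by positivity, by linarith⟩)).2.symm

/-! ### Limits of powers: lifting to nonnegative times -/

/-- Since the projection is open, the image of any neighbourhood of `1` is a neighbourhood of the
identity of `G/H`, so it contains `Y δ` for all small `δ > 0`. Thus lifts `x` of `Y δ` exist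
arbitrarily close to `1`. -/
theorem neBot_lifts (hn : A.IsNormalSublocalGroup H V) (hw : A.IsCosetNhd V W)
    (Y : LocalOnePS (quotient hn hw)) :
    NeBot ((𝓝[>] (0 : ℝ) ×ˢ 𝓝 (⟨A.one, hw.one_mem⟩ : W)) ⊓
      𝓟 {p : ℝ × W | cosetMk hn hw p.2 = Y.toFun p.1}) := by
  rw [← frequently_mem_iff_neBot, Filter.Frequently]
  intro h
  obtain ⟨D, hD, N, hN, hDN⟩ := mem_prod_iff.1 h
  have h1 : Tendsto Y.toFun (𝓝[>] 0) (𝓝 (cosetMk hn hw ⟨A.one, hw.one_mem⟩)) := by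
    have := (LocalOnePS.continuousAt (Y := Y) (t := 0) (by simpa using Y.radius_pos)).tendsto
    rw [Y.map_zero] at this
    exact this.mono_left nhdsWithin_le_nhds
  obtain ⟨δ, hδ, hδD⟩ := ((h1.eventually ((isOpenMap_cosetMk hn hw).image_mem_nhds hN)).and hD).exists
  obtain ⟨x, hx, hxδ⟩ := hδ
  exact hDN (show (δ, x) ∈ D ×ˢ N from ⟨hδD, hx⟩) hxδ

theorem natFloor_add_eq_or {a b : ℝ} (ha : 0 ≤ a) (hb : 0 ≤ b) :
    ⌊a + b⌋₊ = ⌊a⌋₊ + ⌊b⌋₊ ∨ ⌊a + b⌋₊ = ⌊a⌋₊ + ⌊b⌋₊ + 1 := by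
  have h1 : ⌊a⌋₊ + ⌊b⌋₊ ≤ ⌊a + b⌋₊ := Nat.le_floor (by
    push_cast
    exact add_le_add (Nat.floor_le ha) (Nat.floor_le hb))
  have h2 : ⌊a + b⌋₊ < ⌊a⌋₊ + ⌊b⌋₊ + 2 := (Nat.floor_lt (add_nonneg ha hb)).2 (by
    push_cast
    linarith [Nat.lt_floor_add_one a, Nat.lt_floor_add_one b])
  omega

/-- A lift of `Y` to nonnegative times, obtained as a limit of powers of lifts of `Y δ`. -/
theorem exists_lift_nonneg [LocallyCompactSpace G]
    (hn : A.IsNormalSublocalGroup H V) (hw : A.IsCosetNhd V W) (htd : IsTotallyDisconnected H)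
    (Y : LocalOnePS (quotient hn hw)) :
    ∃ r : ℝ, 0 < r ∧ (r : EReal) < Y.radius ∧ ∃ Z : ℝ → W,
      (∀ t ∈ Icc 0 r, cosetMk hn hw (Z t) = Y.toFun t) ∧
      (∀ s t, 0 ≤ s → 0 ≤ t → s + t ≤ r → (Z (s + t) : G) = A.mul (Z s) (Z t)) ∧
      Tendsto (fun t => (Z t : G)) (𝓝[≥] 0) (𝓝 A.one) := by
  have := A.t2
  have := t2Space_cosetSpace hn hw
  have := neBot_lifts hn hw Y
  -- One ultrafilter makes all the limits, for every `t` at once, converge without passing to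
  -- subsequences; this compatibility is what allows limits at different times to be multiplied.
  obtain ⟨𝓤, h𝓤⟩ := Ultrafilter.exists_le ((𝓝[>] (0 : ℝ) ×ˢ 𝓝 (⟨A.one, hw.one_mem⟩ : W)) ⊓
      𝓟 {p : ℝ × W | cosetMk hn hw p.2 = Y.toFun p.1})
  have hY𝓤 : ∀ᶠ p : ℝ × W in 𝓤, cosetMk hn hw p.2 = Y.toFun p.1 :=
    h𝓤 (mem_inf_of_right (mem_principal_self _))
  have hprod := h𝓤.trans inf_le_left
  have hδ0 : Tendsto Prod.fst (𝓤 : Filter (ℝ × W)) (𝓝[>] 0) := tendsto_fst.mono_left hprod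
  have hδpos : ∀ᶠ p : ℝ × W in 𝓤, 0 < p.1 := hδ0 self_mem_nhdsWithin
  have hx1 : Tendsto (fun p : ℝ × W => (p.2 : G)) 𝓤 (𝓝 A.one) :=
    (continuous_subtype_val.tendsto (⟨A.one, hw.one_mem⟩ : W)).comp
      (tendsto_snd.mono_left hprod)
  have hfl : ∀ {t δ : ℝ}, 0 ≤ t → 0 < δ → ⌊t / δ⌋₊ * δ ≤ t := fun ht hδ =>
    (le_div_iff₀ hδ).1 (Nat.floor_le (div_nonneg ht hδ.le))
  have hfl' : ∀ {t δ : ℝ}, 0 < δ → t - δ ≤ ⌊t / δ⌋₊ * δ := fun {t δ} hδ => by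
    have := (div_lt_iff₀ hδ).1 (Nat.lt_floor_add_one (t / δ))
    linarith
  obtain ⟨r, hr, hrY, K, hK, hKW, N, hN, hpow⟩ := exists_npow_mem hn hw htd Y univ_mem
  have hpow𝓤 : ∀ᶠ p : ℝ × W in 𝓤, ∀ i : ℕ, i * p.1 ≤ r → ∃ w : W, (w : G) = A.npow p.2 i ∧
      (w : G) ∈ K ∧ cosetMk hn hw w = Y.toFun (i * p.1) := by
    filter_upwards [hδpos, hY𝓤, hx1 hN] with p h1 h2 h3 using hpow p.1 h1 p.2 h3 h2
  set f : ℝ → ℝ × W → G := fun t p => A.npow p.2 ⌊t / p.1⌋₊ with hf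
  have hlim : ∀ t : ℝ, ∃ z : W, t ∈ Icc 0 r → Tendsto (f t) 𝓤 (𝓝 (z : G)) := by
    intro t
    by_cases ht : t ∈ Icc 0 r
    · have hfK : ∀ᶠ p in 𝓤, f t p ∈ K := by
        filter_upwards [hδpos, hpow𝓤] with p h1 h2
        obtain ⟨w, hwf, hwK, -⟩ := h2 _ ((hfl ht.1 h1).trans ht.2)
        exact (show _ = f t p from hwf) ▸ hwK
      obtain ⟨z, hzK, hz⟩ := hK.ultrafilter_le_nhds (𝓤.map (f t)) (le_principal_iff.2 hfK)
      exact ⟨⟨z, (hKW hzK).1⟩, fun _ => hz⟩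
    -- Outside `[0, r]` the value is arbitrary.
    · exact ⟨⟨A.one, hw.one_mem⟩, fun h => absurd h ht⟩
  choose Z hZ using hlim
  refine ⟨r, hr, hrY, Z, fun t ht => ?_, fun s t hs ht hst => ?_, ?_⟩
  · classical
    -- `f t` regarded as a map into `W`, so that the projection applies. The default value does not
    -- matter, since `f t` is eventually in `W`.
    set g : ℝ × W → W := fun p => if h : f t p ∈ W then ⟨f t p, h⟩ else ⟨A.one, hw.one_mem⟩
    have hg : ∀ᶠ p in 𝓤, (g p : G) = f t p ∧
        cosetMk hn hw (g p) = Y.toFun (⌊t / p.1⌋₊ * p.1) := by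
      filter_upwards [hδpos, hpow𝓤] with p h1 h2
      obtain ⟨w, hwf, -, hwY⟩ := h2 _ ((hfl ht.1 h1).trans ht.2)
      have hwf' : f t p = w := hwf.symm
      have hgw : g p = w := by simp only [g, hwf', w.2, dif_pos]
      rw [hgw]
      exact ⟨hwf, hwY⟩
    have hgz : Tendsto g 𝓤 (𝓝 (Z t)) :=
      tendsto_subtype_rng.2 ((hZ t ht).congr' (hg.mono fun p hp => hp.1.symm))
    have h1 := ((continuous_cosetMk hn hw).tendsto _).comp hgz
    -- `⌊t / δ⌋ * δ` is squeezed between `t - δ` and `t`.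
    have h2 : Tendsto (fun p : ℝ × W => (⌊t / p.1⌋₊ * p.1 : ℝ)) 𝓤 (𝓝 t) := by
      have h3 : Tendsto (fun p : ℝ × W => t - p.1) 𝓤 (𝓝 t) := by
        simpa using tendsto_const_nhds.sub (hδ0.mono_right nhdsWithin_le_nhds)
      exact tendsto_of_tendsto_of_tendsto_of_le_of_le' h3 tendsto_const_nhds
        (hδpos.mono fun p hp => hfl' hp) (hδpos.mono fun p hp => hfl ht.1 hp)
    have h4 := (LocalOnePS.continuousAt (Y := Y) (t := t)
      (LocalOnePS.abs_lt_radius hrY (by rw [abs_of_nonneg ht.1]; exact ht.2))).tendsto.comp h2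
    exact tendsto_nhds_unique h1 (h4.congr' (hg.mono fun p hp => hp.2.symm))
  · have hs' : s ∈ Icc 0 r := ⟨hs, by linarith⟩
    have ht' : t ∈ Icc 0 r := ⟨ht, by linarith⟩
    have hst' : s + t ∈ Icc 0 r := ⟨by linarith, hst⟩
    have hm : ∀ x y : W, ContinuousAt (fun p : G × G => A.mul p.1 p.2) ((x : G), (y : G)) :=
      fun x y => A.continuousOn_mul.continuousAt
        (A.isOpen_mulDom.mem_nhds (hw.mul_mem_dom x.2 y.2))
    have h1 : Tendsto (fun p => A.mul (f s p) (f t p)) 𝓤 (𝓝 (A.mul (Z s) (Z t))) :=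
      (hm (Z s) (Z t)).tendsto.comp ((hZ s hs').prodMk_nhds (hZ t ht'))
    -- The possible extra factor `x` tends to `1` and so leaves the limit unchanged.
    have h2 : Tendsto (fun p : ℝ × W => A.mul (A.mul (f s p) (f t p)) p.2) 𝓤
        (𝓝 (A.mul (Z s) (Z t))) := by
      have h3 : ContinuousAt (fun p : G × G => A.mul p.1 p.2) (A.mul (Z s) (Z t), A.one) :=
        A.continuousOn_mul.continuousAt (A.isOpen_mulDom.mem_nhds (A.one_right_mem _))
      have h4 := h3.tendsto.comp (h1.prodMk_nhds hx1)
      simpa only [A.mul_one] using! h4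
    -- For each `p` the value `f (s + t) p` is one of two products, depending on the floors; as both
    -- tend to `Z s · Z t`, so does `f (s + t)`, whichever case occurs.
    refine tendsto_nhds_unique (hZ (s + t) hst') fun Q hQ => mem_map.2 ?_
    filter_upwards [hδpos, hpow𝓤, h1 hQ, h2 hQ] with p hp hpp hp1 hp2
    have hpW : ∀ i ≤ ⌊(s + t) / p.1⌋₊, A.npow p.2 i ∈ W := fun i hi => by
      obtain ⟨w, hwi, -⟩ := hpp i ((mul_le_mul_of_nonneg_right (by exact_mod_cast hi) hp.le).trans
        ((hfl hst'.1 hp).trans hst))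
      exact hwi ▸ w.2
    have hfst : f (s + t) p = A.npow p.2 ⌊s / p.1 + t / p.1⌋₊ := by rw [hf, ← add_div]
    rw [add_div] at hpW
    rcases natFloor_add_eq_or (div_nonneg hs hp.le) (div_nonneg ht hp.le) with e | e
    · have e1 := npow_add hw p.2.2 hpW ⌊s / p.1⌋₊ ⌊t / p.1⌋₊ e.ge
      rw [mem_preimage, hfst, e, e1]
      exact hp1
    · have e1 := npow_add hw p.2.2 hpW ⌊s / p.1⌋₊ ⌊t / p.1⌋₊ (by omega)
      rw [mem_preimage, hfst, e, npow, e1]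
      exact hp2
  · intro Q hQ
    rw [mem_map]
    -- The trapping argument is repeated with a compact set inside `Q`. The same ultrafilter
    -- eventually enters the new `N'`, so the limits `Z t` already constructed lie in `K' ⊆ Q` for
    -- small `t`.
    obtain ⟨ε, hε, -, K', hK', hKQ, N', hN', hpow'⟩ := exists_npow_mem hn hw htd Y hQ
    filter_upwards [Icc_mem_nhdsGE (lt_min hr hε)] with t ht
    have htr : t ∈ Icc 0 r := ⟨ht.1, ht.2.trans (min_le_left _ _)⟩
    refine (hKQ (hK'.isClosed.mem_of_tendsto (hZ t htr) ?_)).2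
    filter_upwards [hδpos, hY𝓤, hx1 hN'] with p h1 h2 h3
    obtain ⟨w, hwf, hwK, -⟩ := hpow' p.1 h1 p.2 h3 h2 _
      ((hfl ht.1 h1).trans (ht.2.trans (min_le_right _ _)))
    exact (show _ = f t p from hwf) ▸ hwK

/-! ### Extension to negative times -/

/-- A multiplicative map on `[0, r]` that is continuous at `0` extends, by inversion, to a local
1-parameter subgroup. -/
theorem exists_localOnePS_of_nonneg (hw : A.IsCosetNhd V W) {r : ℝ} (hr : 0 < r)
    {Z : ℝ → W}
    (hadd : ∀ s t, 0 ≤ s → 0 ≤ t → s + t ≤ r → (Z (s + t) : G) = A.mul (Z s) (Z t))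
    (hlim : Tendsto (fun t => (Z t : G)) (𝓝[≥] 0) (𝓝 A.one)) :
    ∃ X : LocalOnePS A, X.radius = r ∧ (∀ t, X.toFun t ∈ W) ∧
      ∀ t, 0 ≤ t → X.toFun t = Z t := by
  have := A.t2
  set X : ℝ → G := fun t => if 0 ≤ t then Z t else A.inv (Z (-t)) with hX
  have hpos : ∀ {t}, 0 ≤ t → X t = Z t := fun ht => if_pos ht
  have hneg : ∀ {t}, t < 0 → X t = A.inv (Z (-t)) := fun ht => if_neg (not_le.2 ht)
  have hXW : ∀ t, X t ∈ W := fun t => by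
    rcases le_or_gt 0 t with ht | ht
    · exact hpos ht ▸ (Z t).2
    · exact hneg ht ▸ hw.inv_mem (Z (-t)).2
  have hmul : ∀ s t : ℝ, |s| < r → |t| < r → |s + t| < r → X (s + t) = A.mul (X s) (X t) := by
    intro s t hs ht hst
    rw [abs_lt] at hs ht hst
    rcases le_or_gt 0 s with hs0 | hs0 <;> rcases le_or_gt 0 t with ht0 | ht0
    · rw [hpos hs0, hpos ht0, hpos (add_nonneg hs0 ht0), hadd s t hs0 ht0 hst.2.le]
    · rw [hpos hs0, hneg ht0]
      rcases le_or_gt 0 (s + t) with h0 | h0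
      · rw [hpos h0]
        refine hw.eq_mul_inv (Z _).2 (Z _).2 (Z _).2 ?_
        rw [← hadd _ _ h0 (by linarith) (by linarith), add_neg_cancel_right]
      · rw [hneg h0]
        -- Here `Z (-t) = Z (-(s + t)) · Z s`; inverting both sides and cancelling `(Z s)⁻¹` gives
        -- the claim.
        have e := hadd (-(s + t)) s (by linarith) hs0 (by linarith)
        rw [show -(s + t) + s = -t by ring] at e
        have e' := hw.inv_mul_rev (Z _).2 (Z _).2 (Z _).2 e
        have := hw.eq_inv_mul (hw.inv_mem (Z _).2) (hw.inv_mem (Z _).2) (hw.inv_mem (Z _).2) e'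
        rwa [hw.inv_inv (Z s).2] at this
    · rw [hneg hs0, hpos ht0]
      rcases le_or_gt 0 (s + t) with h0 | h0
      · rw [hpos h0]
        refine hw.eq_inv_mul (Z _).2 (Z _).2 (Z _).2 ?_
        rw [← hadd _ _ (by linarith) h0 (by linarith), neg_add_cancel_left]
      · rw [hneg h0]
        have e := hadd t (-(s + t)) ht0 (by linarith) (by linarith)
        rw [show t + -(s + t) = -s by ring] at e
        have e' := hw.inv_mul_rev (Z _).2 (Z _).2 (Z _).2 e
        have := hw.eq_mul_inv (hw.inv_mem (Z _).2) (hw.inv_mem (Z _).2) (hw.inv_mem (Z _).2) e'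
        rwa [hw.inv_inv (Z t).2] at this
    · rw [hneg hs0, hneg ht0, hneg (add_neg hs0 ht0)]
      refine hw.inv_mul_rev (Z _).2 (Z _).2 (Z _).2 ?_
      rw [← hadd _ _ (by linarith) (by linarith) (by linarith)]
      congr 2
      ring
  have hX0 : Tendsto X (𝓝 0) (𝓝 A.one) := by
    rw [← nhdsLT_sup_nhdsGE, tendsto_sup]
    constructor
    · have h1 : Tendsto (fun t : ℝ => -t) (𝓝[<] 0) (𝓝[≥] 0) := by
        refine tendsto_nhdsWithin_iff.2 ⟨?_, ?_⟩
        · simpa using (continuous_neg.tendsto (0 : ℝ)).mono_left nhdsWithin_le_nhds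
        · filter_upwards [self_mem_nhdsWithin] with t ht using (neg_pos.2 (mem_Iio.1 ht)).le
      have h2 := (A.continuousOn_inv.continuousAt
        (A.isOpen_invDom.mem_nhds A.one_mem_invDom)).tendsto.comp (hlim.comp h1)
      rw [A.inv_one] at h2
      refine h2.congr' ?_
      filter_upwards [self_mem_nhdsWithin] with t ht using (hneg ht).symm
    · refine hlim.congr' ?_
      filter_upwards [self_mem_nhdsWithin] with t ht using (hpos ht).symm
  refine ⟨{
    radius := r
    radius_pos := by exact_mod_cast hr
    toFun := X
    continuousOn := fun t ht => ContinuousAt.continuousWithinAt ?_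
    mem_invDom := fun t _ => hw.symm.1 (hXW t)
    map_add := fun s t hs ht hst => ⟨hw.mul_mem_dom (hXW s) (hXW t),
      hmul s t (by exact_mod_cast hs) (by exact_mod_cast ht) (by exact_mod_cast hst)⟩ },
    rfl, hXW, fun t ht => hpos ht⟩
  have ht' : |t| < r := by exact_mod_cast (show ((|t| : ℝ) : EReal) < r from ht)
  have h1 : Tendsto (fun s => s - t) (𝓝 t) (𝓝 0) := by
    simpa using (continuous_id.sub continuous_const).tendsto t (f := fun s => s - t)
  -- Continuity at `t` comes from continuity at `0` through `X s = X t · X (s - t)`, valid for `s`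
  -- near `t`.
  have h2 : Tendsto (fun s => A.mul (X t) (X (s - t))) (𝓝 t) (𝓝 (X t)) := by
    have h3 : ContinuousAt (fun p : G × G => A.mul p.1 p.2) (X t, A.one) :=
      A.continuousOn_mul.continuousAt (A.isOpen_mulDom.mem_nhds (A.one_right_mem _))
    have h4 := h3.tendsto.comp (tendsto_const_nhds.prodMk_nhds (hX0.comp h1))
    simpa only [A.mul_one] using! h4
  refine h2.congr' ?_
  have hr0 : ∀ᶠ u : ℝ in 𝓝 0, |u| < r :=
    (isOpen_lt continuous_abs continuous_const).mem_nhds (by simpa using hr)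
  filter_upwards [h1.eventually hr0, (isOpen_lt continuous_abs continuous_const).mem_nhds ht']
    with s hs hs'
  have hs'' : |t + (s - t)| < r := by simpa using hs'
  rw [← hmul t (s - t) ht' hs hs'', add_sub_cancel]

/-! ### Lifting germs and surjectivity -/

/-- Local 1-parameter subgroups lift along the projection `G → G/H`. -/
theorem exists_localOnePS_lift [LocallyCompactSpace G]
    (hn : A.IsNormalSublocalGroup H V) (hw : A.IsCosetNhd V W) (htd : IsTotallyDisconnected H)
    (Y : LocalOnePS (quotient hn hw)) :
    ∃ (X : LocalOnePS A) (r : ℝ), 0 < r ∧ (r : EReal) < Y.radius ∧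
      ∀ t, |t| ≤ r → ∃ h : X.toFun t ∈ W, cosetMk hn hw ⟨X.toFun t, h⟩ = Y.toFun t := by
  obtain ⟨r, hr, hrY, Z, hZY, hadd, hlim⟩ := exists_lift_nonneg hn hw htd Y
  obtain ⟨X, hXr, hXW, hXZ⟩ := exists_localOnePS_of_nonneg hw hr hadd hlim
  have key : ∀ t, 0 ≤ t → t ≤ r → cosetMk hn hw ⟨X.toFun t, hXW t⟩ = Y.toFun t :=
    fun t h0 ht => by
      rw [← hZY t ⟨h0, ht⟩]
      exact congrArg _ (Subtype.ext (hXZ t h0))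
  -- `X` has radius exactly `r`, and the inversion rule needs `|t| < r` strictly; passing to `r / 2`
  -- ensures this.
  refine ⟨X, r / 2, half_pos hr, lt_trans (by exact_mod_cast half_lt_self hr) hrY,
    fun t ht => ⟨hXW t, ?_⟩⟩
  rw [abs_le] at ht
  rcases le_or_gt 0 t with h0 | h0
  · exact key t h0 (by linarith)
  · have hr' : |(-t)| < r := by rw [abs_lt]; constructor <;> linarith
    have e1 := X.map_neg (t := -t) (by rw [hXr]; exact_mod_cast hr')
    have e2 := Y.map_neg (t := -t) (LocalOnePS.abs_lt_radius hrY hr'.le)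
    rw [neg_neg] at e1 e2
    rw [e2, ← key (-t) (by linarith) (by linarith)]
    exact Eq.trans (congrArg _ (Subtype.ext e1)) (cosetInv_mk hn hw _).symm

end LocalGroup

/-- Let `G` be a locally compact local group, with inversion defined everywhere and such that
`(h⁻¹, g⁻¹) ∈ Ω` and `(gh)⁻¹ = h⁻¹g⁻¹` whenever `(g, h) ∈ Ω`. If `H` is a totally disconnected
normal sublocal group of `G` and `π : G → G/H` is the canonical projection, then
`L(π) : L(G) → L(G/H)` is surjective. -/
theorem lemmaL {G : Type u} [TopologicalSpace G] [LocallyCompactSpace G] (A : LocalGroup G)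
    (hinv : A.invDom = Set.univ)
    (hmulinv : ∀ g h : G, (g, h) ∈ A.mulDom →
      (A.inv h, A.inv g) ∈ A.mulDom ∧ A.inv (A.mul g h) = A.mul (A.inv h) (A.inv g))
    (H V W : Set G) (hH : A.IsNormalSublocalGroup H V) (hW : A.IsCosetNhd V W)
    (htd : IsTotallyDisconnected H) :
    Function.Surjective
      (LocalGroup.LocalMorphism.mapL (LocalGroup.proj hH hW) :
        LocalGroup.L A → LocalGroup.L (LocalGroup.quotient hH hW)) := by
  intro y
  obtain ⟨Y, rfl⟩ := Quotient.exists_rep y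
  obtain ⟨X, r, hr, hrY, hX⟩ := LocalGroup.exists_localOnePS_lift hH hW htd Y
  refine ⟨Quotient.mk _ X, Quotient.sound ?_⟩
  -- The radius of the composite is some unspecified positive number, and equality of germs needs an
  -- interval strictly inside both domains; hence an auxiliary `a` below it.
  obtain ⟨a, ha0, ha⟩ := EReal.lt_iff_exists_real_btwn.1 (LocalGroup.PartialMorphism.comp
    ⟨W, hW.isOpen, hW.one_mem, LocalGroup.projHom hH hW⟩ X).radius_pos
  refine ⟨min r a, lt_min hr (by exact_mod_cast ha0),
    lt_of_le_of_lt (by exact_mod_cast min_le_right r a) ha,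
    lt_of_le_of_lt (by exact_mod_cast min_le_left r a) hrY, fun t ht => ?_⟩
  obtain ⟨hW', e⟩ := hX t ((abs_lt.2 ht).le.trans (min_le_left _ _))
  exact (dif_pos hW').trans e
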